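/- All matrices are finite-dimensional and complex, and $\|\cdot\|$ is the operator norm. An *$\epsilon$-soft torus* is a tuple of unitaries $U_1,\dots,U_d$ ($d\ge 1$) with $\|[U_i,U_j]\|\le\epsilon$ for all $i,j$. An *$\epsilon$-local projector* is a tuple of exactly commuting unitaries $U_1,\dots,U_d$ together with an orthogonal projector $P$ such that $\|[P,U_i]\|\le\epsilon$ for all $i$. For invertible $X$, $\mathrm{polar}(X)=X(X^\dagger X)^{-1/2}$. *The map $\mathcal G$.* Given an $\epsilon$-local projector with $\epsilon<0.6$, written in a basis where $P=\begin{pmatrix}I&0\\0&0\end{pmatrix}$, let $U_i^{11}$ be the upper left block of $U_i$; $\mathcal G$ maps it to the tuple $\mathrm{polar}(U_1^{11}),\dots,\mathrm{polar}(U_d^{11})$. *The map $\mathcal F$.* Fix a window $F:\mathbb R\to[0,\infty)$ with $F(x)=0$ for $|x|\ge1$, $F(x-1)+F(x)+F(x+1)=1$ for $|x|\le1$, and $F^{1/2}$ infinitely differentiable. Let $U_1,\dots,U_d$ be an $\epsilon$-soft torus on a space $\mathcal H$, $\epsilon>0$, put $X_i=(U_i+U_i^\dagger)/2$, $Y_i=(U_i-U_i^\dagger)/(2i)$,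 and let $\Delta>0$. For $\vec m,\vec n\in\mathbb Z^d$ with $|m_i|,|n_i|\le\lceil1/\Delta\rceil$ let $$A_{\vec m,\vec n}=F\left(\tfrac{X_1}{\Delta}-m_1\right)^{1/2}\cdots F\left(\tfrac{X_d}{\Delta}-m_d\right)^{1/2}F\left(\tfrac{Y_1}{\Delta}-n_1\right)^{1/2}\cdots F\left(\tfrac{Y_d}{\Delta}-n_d\right)^{1/2},\qquad E_{\vec m,\vec n}=A_{\vec m,\vec n}A_{\vec m,\vec n}^\dagger .$$ A Naimark dilation of $(E_{\vec m,\vec n})$ is a family of mutually orthogonal projectors $Q_{\vec m,\vec n}$ with sum $I$ on a space $\mathcal H'=\mathcal H\oplus\mathcal H''$ such that $\Pi Q_{\vec m,\vec n}\Pi$ restricted to $\mathcal H$ is $E_{\vec m,\vec n}$, where $\Pi$ is the projector of $\mathcal H'$ onto $\mathcal H$. Put $X_i'=\sum m_i\Delta\,Q_{\vec m,\vec n}$, $Y'_i=\sum n_i\Delta\,Q_{\vec m,\vec n}$, $V_i=X'_i+iY'_i$, choose a complex $z$ with $|z|=1$ such that $V_i+xz$ is invertible for all $i$ and all $0<x\le1$,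 and put $U'_i=\lim_{x\to0^+}\mathrm{polar}(V_i+xz)$. For $\Delta=\sqrt{d\epsilon}$, $\mathcal F$ maps $(U_i)$ to $(\Pi;U'_1,\dots,U'_d)$. **Theorem.** Window functions as above exist, and for every such $F$ there is a constant $C>0$, depending only on $F$, such that the following holds for all $d\ge1$, all $\epsilon>0$ and all $\epsilon$-soft tori $U_1,\dots,U_d$ of any finite matrix size. 1. For every $\Delta>0$, the $E_{\vec m,\vec n}$ form a POVM, and there are a (finite-dimensional) Naimark dilation, a number $z$ and limits $U'_i$ as above. 2. For every $\Delta>0$, every choice of the Naimark dilation and of $z$ in the construction, and every $i$, $$\|\Pi X'_i\Pi|_{\mathcal H}-X_i\|\le C(\Delta+d\epsilon\Delta^{-1}),\qquad \|\Pi Y'_i\Pi|_{\mathcal H}-Y_i\|\le C(\Delta+d\epsilon\Delta^{-1}),\qquad \|\Pi(U'_i-V_i)\Pi\|\le C(\Delta+d\epsilon\Delta^{-1})^{1/2}.$$ 3. For $\Delta=\sqrt{d\epsilon}$ and every choice in the construction, these three norms are at most $C\sqrt{d\epsilon}$, $C\sqrt{d\epsilon}$ and $C(d\epsilon)^{1/4}$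 respectively. Moreover $\Pi$ and $U'_1,\dots,U'_d$ form a $C(d\epsilon)^{1/4}$-local projector: the $U'_i$ are exactly commuting unitaries and $\|[\Pi,U'_i]\|\le C(d\epsilon)^{1/4}$. 4. For $\Delta=\sqrt{d\epsilon}$ and every choice in the construction, whenever $\mathcal G$ is defined on this local projector, i.e. it is $\delta$-local for some $\delta<0.6$ (in particular whenever $C(d\epsilon)^{1/4}<0.6$), the upper left blocks of the $U'_i$ are invertible, the unitaries $\mathrm{polar}((U'_i)^{11})$ of $\mathcal G\circ\mathcal F(U_1,\dots,U_d)$ satisfy $\|\mathrm{polar}((U'_i)^{11})-U_i\|\le C(d\epsilon)^{1/4}$ for all $i$, and they form a $C(d\epsilon)^{1/2}$-soft torus. -/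

import Mathlib

open Filter Topology
open scoped Matrix ContDiff ComplexOrder Matrix.Norms.L2Operator

noncomputable section

/-! All matrices below carry the operator norm induced by the Euclidean (Hilbert space) norm. -/

/-- An `ε`-soft torus: a tuple of unitaries that pairwise commute up to `ε` in operator norm. -/
def IsSoftTorus {ι : Type*} [Fintype ι] [DecidableEq ι] {d : ℕ} (ε : ℝ)
    (U : Fin d → Matrix ι ι ℂ) : Prop :=
  (∀ i, U i ∈ Matrix.unitaryGroup ι ℂ) ∧ ∀ i j, ‖U i * U j - U j * U i‖ ≤ ε

/-- An `ε`-local projector: exactly commuting unitaries together with an orthogonal projector `P`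
that commutes with each of them up to `ε` in operator norm. -/
structure IsLocalProjector {ι : Type*} [Fintype ι] [DecidableEq ι] {d : ℕ} (ε : ℝ)
    (P : Matrix ι ι ℂ) (U : Fin d → Matrix ι ι ℂ) : Prop where
  isProj : IsStarProjection P
  unitary : ∀ i, U i ∈ Matrix.unitaryGroup ι ℂ
  commute : ∀ i j, U i * U j = U j * U i
  norm_comm_le : ∀ i, ‖P * U i - U i * P‖ ≤ ε

/-- `polar X = X (Xᴴ X)^(-1/2)`, the power being taken by functional calculus
(meaningful for invertible `X`). -/
def polar {ι : Type*} [Fintype ι] [DecidableEq ι] (X : Matrix ι ι ℂ) : Matrix ι ι ℂ :=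
  X * cfc (fun t : ℝ => (√t)⁻¹) (Xᴴ * X)

/-- The orthogonal projector of `ℂ^N ⊕ ℂ^K` onto its first summand. -/
def blockProj (N K : ℕ) : Matrix (Fin N ⊕ Fin K) (Fin N ⊕ Fin K) ℂ :=
  Matrix.fromBlocks 1 0 0 0

/-- The map `𝒢`, for local projectors whose projector is in the block form
`blockProj N K`: the polar parts of the upper left blocks. -/
def mapG {d N K : ℕ} (W : Fin d → Matrix (Fin N ⊕ Fin K) (Fin N ⊕ Fin K) ℂ)
    (i : Fin d) : Matrix (Fin N) (Fin N) ℂ :=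
  polar (W i).toBlocks₁₁

/-- The admissible window functions of the soft measurements. -/
structure IsWindow (F : ℝ → ℝ) : Prop where
  eq_zero : ∀ x, 1 ≤ |x| → F x = 0
  sum_eq_one : ∀ x, |x| ≤ 1 → F (x - 1) + F x + F (x + 1) = 1
  nonneg : ∀ x, 0 ≤ F x
  smooth_sqrt : ContDiff ℝ ∞ (fun x => √(F x))

/-- The Hermitian part `(U + Uᴴ) / 2`. -/
def rePart {ι : Type*} (U : Matrix ι ι ℂ) : Matrix ι ι ℂ :=
  (1 / 2 : ℂ) • (U + Uᴴ)

/-- The skew part `(U - Uᴴ) / (2 i)`, again a Hermitian matrix. -/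
def imPart {ι : Type*} (U : Matrix ι ι ℂ) : Matrix ι ι ℂ :=
  (1 / (2 * Complex.I)) • (U - Uᴴ)

/-- The possible values of one integer label: integers `m` with `|m| ≤ ⌈1 / Δ⌉`. -/
abbrev Label (Δ : ℝ) : Type :=
  {m : ℤ // m ∈ Finset.Icc (-⌈1 / Δ⌉) ⌈1 / Δ⌉}

/-- The measurement outcomes: pairs `(m, n)` of `d`-tuples of labels. -/
abbrev Outcome (d : ℕ) (Δ : ℝ) : Type :=
  (Fin d → Label Δ) × (Fin d → Label Δ)

/-- `F (X / Δ - m) ^ (1/2)`, by functional calculus of the Hermitian matrix `X`. -/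
def softFactor {N : ℕ} (F : ℝ → ℝ) (Δ : ℝ) (X : Matrix (Fin N) (Fin N) ℂ) (m : ℤ) :
    Matrix (Fin N) (Fin N) ℂ :=
  cfc (fun x : ℝ => √(F (x / Δ - m))) X

/-- The ordered product of the soft factors of `X_1, …, X_d`, then those of `Y_1, …, Y_d`. -/
def softKraus {d N : ℕ} (F : ℝ → ℝ) (Δ : ℝ) (U : Fin d → Matrix (Fin N) (Fin N) ℂ)
    (a : Outcome d Δ) : Matrix (Fin N) (Fin N) ℂ :=
  (List.ofFn fun i => softFactor F Δ (rePart (U i)) (a.1 i)).prod *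
    (List.ofFn fun i => softFactor F Δ (imPart (U i)) (a.2 i)).prod

/-- The operators `E = A Aᴴ` of the soft measurement. -/
def softPOVM {d N : ℕ} (F : ℝ → ℝ) (Δ : ℝ) (U : Fin d → Matrix (Fin N) (Fin N) ℂ)
    (a : Outcome d Δ) : Matrix (Fin N) (Fin N) ℂ :=
  softKraus F Δ U a * (softKraus F Δ U a)ᴴ

/-- A positive operator-valued measure with finitely many outcomes. -/
structure IsPOVM {κ ι : Type*} [Fintype κ] [Fintype ι] [DecidableEq ι]
    (E : κ → Matrix ι ι ℂ) : Prop where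
  posSemidef : ∀ a, (E a).PosSemidef
  sum_eq_one : ∑ a, E a = 1

/-- `Q` is a Naimark dilation of `E` to `ℂ^N ⊕ ℂ^K`: mutually orthogonal projectors that sum to the
identity and whose compressions to the first summand are the operators `E`. -/
structure IsNaimarkDilation {κ : Type*} [Fintype κ] {N K : ℕ}
    (E : κ → Matrix (Fin N) (Fin N) ℂ)
    (Q : κ → Matrix (Fin N ⊕ Fin K) (Fin N ⊕ Fin K) ℂ) : Prop where
  isProj : ∀ a, IsStarProjection (Q a)
  orthogonal : ∀ a b, a ≠ b → Q a * Q b = 0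
  sum_eq_one : ∑ a, Q a = 1
  compress : ∀ a, (Q a).toBlocks₁₁ = E a

/-- `X'_i = ∑ m_i Δ Q_{m,n}`. -/
def dilX {d N K : ℕ} {Δ : ℝ} (Q : Outcome d Δ → Matrix (Fin N ⊕ Fin K) (Fin N ⊕ Fin K) ℂ)
    (i : Fin d) : Matrix (Fin N ⊕ Fin K) (Fin N ⊕ Fin K) ℂ :=
  ∑ a, ((((a.1 i : ℤ) : ℝ) * Δ : ℝ) : ℂ) • Q a

/-- `Y'_i = ∑ n_i Δ Q_{m,n}`. -/
def dilY {d N K : ℕ} {Δ : ℝ} (Q : Outcome d Δ → Matrix (Fin N ⊕ Fin K) (Fin N ⊕ Fin K) ℂ)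
    (i : Fin d) : Matrix (Fin N ⊕ Fin K) (Fin N ⊕ Fin K) ℂ :=
  ∑ a, ((((a.2 i : ℤ) : ℝ) * Δ : ℝ) : ℂ) • Q a

/-- `V_i = X'_i + i Y'_i`. -/
def dilV {d N K : ℕ} {Δ : ℝ} (Q : Outcome d Δ → Matrix (Fin N ⊕ Fin K) (Fin N ⊕ Fin K) ℂ)
    (i : Fin d) : Matrix (Fin N ⊕ Fin K) (Fin N ⊕ Fin K) ℂ :=
  dilX Q i + Complex.I • dilY Q i

/-- `(blockProj N K, U')` is an image of the tuple `U` under the soft-measurement construction with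
window `F` and width `Δ`, for the choice `Q` of a Naimark dilation and the choice `z` of a unit
complex number: `U'_i = lim_{x → 0+} polar (V_i + x z)`. -/
structure IsMapF {d N K : ℕ} (F : ℝ → ℝ) (Δ : ℝ) (U : Fin d → Matrix (Fin N) (Fin N) ℂ)
    (Q : Outcome d Δ → Matrix (Fin N ⊕ Fin K) (Fin N ⊕ Fin K) ℂ) (z : ℂ)
    (U' : Fin d → Matrix (Fin N ⊕ Fin K) (Fin N ⊕ Fin K) ℂ) : Prop where
  dilation : IsNaimarkDilation (softPOVM F Δ U) Q
  norm_z : ‖z‖ = 1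
  isUnit_shift : ∀ i, ∀ x : ℝ, 0 < x → x ≤ 1 → IsUnit (dilV Q i + ((x : ℂ) * z) • 1)
  tendsto_polar : ∀ i, Tendsto (fun x : ℝ => polar (dilV Q i + ((x : ℂ) * z) • 1))
    (𝓝[>] 0) (𝓝 (U' i))

end

noncomputable section

/-! ### Conjugation by a row contraction -/

/-! Everything rests on the first two moments of the soft measurement. Each of its 2d steps acts by
a unital map X ↦ ∑ B_m X B_mᴴ, which is a contraction (`Matrix.norm_sum_mul_mul_conjTranspose_le`).
If every such map moves X_i by at most r, then ∑ m_i Δ E is X_i up to 2dr plus an error O(Δ) of the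
single measurement of X_i. The same holds for Y_i and for the squares
(`IsWindow.exists_softPOVM_moments_le`).

The crux is r = O(ε/Δ), with no factor for the roughly 1/Δ labels
(`IsWindow.exists_norm_channel_sub_le`). A discrete Fourier transform over the labels replaces the
B_m by modulated sums G_j. By Poisson summation each G_j is an absolutely convergent series of
characters of H/Δ, with constants independent of j and Δ, so it is bounded and commutes with X up to
O(‖[X,H]‖/Δ). The channel moves X by the mean of the G_j [X, G_jᴴ].

On the dilated space let J be the inclusion of the first summand and b = Δ + dε/Δ. The two moments
bound a variance: ‖X'J - JX‖² = O(b), which is where the power 1/2 originates. Since X² + Y² = 1,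
also (1 - X'² - Y'²)J = O(√b). For the limiting phase u of an eigenvalue v of V one has u - v = u (1
- |v|²)/(1 + |v|), even at v = 0, so (U' - V)J = O(√b). Hence U'J ≈ JU and U'ᴴJ ≈ JUᴴ, and therefore
U' almost commutes with JJᴴ (`IsMapF.norm_intertwine_le`).

For 𝒢, compression to a block is multiplicative up to a product of two commutators with the
projector. So both the polar correction and the commutators of the blocks are quadratic in the
locality, which turns (dε)^(1/4) into (dε)^(1/2) (`mapG_estimates`). The width √(dε) balances the
two terms of b. -/

theorem ContinuousLinearMap.norm_sum_mul_mul_star_le {κ E : Type*} [Fintype κ]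
    [NormedAddCommGroup E] [InnerProductSpace ℂ E] [CompleteSpace E]
    {B Z : κ → E →L[ℂ] E} {M : ℝ} (hM : 0 ≤ M)
    (hB : ∑ a, B a * star (B a) = 1) (hZ : ∀ a, ‖Z a‖ ≤ M) :
    ‖∑ a, B a * Z a * star (B a)‖ ≤ M := by
  have key : ∀ x : E, ∑ a, ‖star (B a) x‖ ^ 2 = ‖x‖ ^ 2 := by
    intro x
    have h : (∑ a, inner ℂ x ((B a * star (B a)) x)) = inner ℂ x x := by
      rw [← inner_sum, ← sum_apply, hB]; rfl
    have h2 : ∀ a, inner ℂ x ((B a * star (B a)) x) = ((‖star (B a) x‖ ^ 2 : ℝ) : ℂ) := by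
      intro a
      rw [mul_apply_eq_comp, ← ContinuousLinearMap.adjoint_inner_left,
        ← ContinuousLinearMap.star_eq_adjoint, inner_self_eq_norm_sq_to_K]
      push_cast; rfl
    simp_rw [h2] at h
    rw [inner_self_eq_norm_sq_to_K] at h
    have h3 := congrArg Complex.re h
    rw [← Complex.ofReal_sum, Complex.ofReal_re] at h3
    rw [h3]
    simp [← Complex.ofReal_pow]
  refine ContinuousLinearMap.opNorm_le_bound _ hM fun x => ?_
  set y := (∑ a, B a * Z a * star (B a)) x with hy
  -- Pair y with itself, move each `B a` across, and apply Cauchy–Schwarz over a; by `key` the two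
  -- resulting factors are ‖y‖ and ‖x‖.
  have h1 : ‖y‖ ^ 2 ≤ M * ‖x‖ * ‖y‖ := by
    have : (inner ℂ y y : ℂ) = ∑ a, inner ℂ (star (B a) y) (Z a (star (B a) x)) := by
      nth_rewrite 2 [hy]
      rw [sum_apply, inner_sum]
      refine Finset.sum_congr rfl fun a _ => ?_
      rw [ContinuousLinearMap.star_eq_adjoint, ContinuousLinearMap.adjoint_inner_left]; rfl
    have h3 : ‖y‖ ^ 2 ≤ ∑ a, M * (‖star (B a) y‖ * ‖star (B a) x‖) := by
      calc ‖y‖ ^ 2 = ‖(inner ℂ y y : ℂ)‖ := by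
            rw [inner_self_eq_norm_sq_to_K]; simp
        _ ≤ ∑ a, ‖inner ℂ (star (B a) y) (Z a (star (B a) x))‖ := by
            rw [this]; exact norm_sum_le _ _
        _ ≤ _ := by
            refine Finset.sum_le_sum fun a _ => (norm_inner_le_norm _ _).trans ?_
            have := (Z a).le_of_opNorm_le (hZ a) (star (B a) x)
            calc _ ≤ ‖star (B a) y‖ * (M * ‖star (B a) x‖) := by gcongr
              _ = _ := by ring
    rw [← Finset.mul_sum] at h3
    have h4 := Real.sum_mul_le_sqrt_mul_sqrt Finset.univ (fun a => ‖star (B a) y‖)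
      (fun a => ‖star (B a) x‖)
    rw [key, key, Real.sqrt_sq (norm_nonneg _), Real.sqrt_sq (norm_nonneg _)] at h4
    calc _ ≤ _ := h3
      _ ≤ M * (‖y‖ * ‖x‖) := by gcongr
      _ = _ := by ring
  rcases (norm_nonneg y).eq_or_lt with h | h
  · rw [← h]; positivity
  · nlinarith

section Matrices

set_option linter.unusedSectionVars false

variable {κ ι : Type*} [Fintype κ] [Fintype ι] [DecidableEq ι]

theorem Matrix.norm_sum_mul_mul_conjTranspose_le {B Z : κ → Matrix ι ι ℂ} {M : ℝ} (hM : 0 ≤ M)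
    (hB : ∑ a, B a * (B a)ᴴ = 1) (hZ : ∀ a, ‖Z a‖ ≤ M) :
    ‖∑ a, B a * Z a * (B a)ᴴ‖ ≤ M := by
  have h := ContinuousLinearMap.norm_sum_mul_mul_star_le
    (B := fun a => Matrix.toEuclideanCLM (𝕜 := ℂ) (B a))
    (Z := fun a => Matrix.toEuclideanCLM (𝕜 := ℂ) (Z a)) hM
    (by simp only [← map_star, ← map_mul, ← map_sum, Matrix.star_eq_conjTranspose, hB, map_one])
    (fun a => by rw [Matrix.l2_opNorm_toEuclideanCLM]; exact hZ a)
  simpa only [← map_star, ← map_mul, ← map_sum, Matrix.star_eq_conjTranspose,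
    Matrix.l2_opNorm_toEuclideanCLM] using h

theorem Matrix.norm_one_le : ‖(1 : Matrix ι ι ℂ)‖ ≤ 1 := by
  rw [← Matrix.diagonal_one, Matrix.l2_opNorm_diagonal]
  exact (pi_norm_le_iff_of_nonneg zero_le_one).2 fun i => by simp

theorem Matrix.norm_le_one_of_mem_unitaryGroup {U : Matrix ι ι ℂ}
    (hU : U ∈ Matrix.unitaryGroup ι ℂ) : ‖U‖ ≤ 1 := by
  have h : Uᴴ * U = 1 := Matrix.mem_unitaryGroup_iff'.1 hU
  have h1 := Matrix.l2_opNorm_conjTranspose_mul_self U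
  rw [h] at h1
  nlinarith [Matrix.norm_one_le (ι := ι), norm_nonneg U]

/-! ### Projection-valued measures with finitely many outcomes -/

/-- Mutually orthogonal projectors with sum `1`. -/
structure IsPVM (Q : κ → Matrix ι ι ℂ) : Prop where
  isProj : ∀ a, IsStarProjection (Q a)
  orthogonal : ∀ a b, a ≠ b → Q a * Q b = 0
  sum_eq_one : ∑ a, Q a = 1

/-- The normal matrix with spectral projectors `Q` and eigenvalues `c`. -/
def pvmSum (Q : κ → Matrix ι ι ℂ) (c : κ → ℂ) : Matrix ι ι ℂ := ∑ a, c a • Q a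

theorem pvmSum_add (Q : κ → Matrix ι ι ℂ) (c e : κ → ℂ) :
    pvmSum Q (c + e) = pvmSum Q c + pvmSum Q e := by
  simp [pvmSum, add_smul, Finset.sum_add_distrib]

theorem pvmSum_sub (Q : κ → Matrix ι ι ℂ) (c e : κ → ℂ) :
    pvmSum Q (c - e) = pvmSum Q c - pvmSum Q e := by
  simp [pvmSum, sub_smul, Finset.sum_sub_distrib]

theorem pvmSum_smul (Q : κ → Matrix ι ι ℂ) (r : ℂ) (c : κ → ℂ) :
    pvmSum Q (r • c) = r • pvmSum Q c := by
  simp [pvmSum, Finset.smul_sum, mul_smul]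

theorem IsPVM.pvmSum_const {Q : κ → Matrix ι ι ℂ} (hQ : IsPVM Q) (r : ℂ) :
    pvmSum Q (fun _ => r) = r • 1 := by
  rw [pvmSum, ← Finset.smul_sum, hQ.sum_eq_one]

theorem IsPVM.pvmSum_one {Q : κ → Matrix ι ι ℂ} (hQ : IsPVM Q) : pvmSum Q 1 = 1 := by
  simpa using! hQ.pvmSum_const 1

theorem IsPVM.pvmSum_mul {Q : κ → Matrix ι ι ℂ} (hQ : IsPVM Q) (c e : κ → ℂ) :
    pvmSum Q (c * e) = pvmSum Q c * pvmSum Q e := by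
  classical
  rw [pvmSum, pvmSum, pvmSum, Finset.sum_mul]
  refine Finset.sum_congr rfl fun a _ => ?_
  rw [Finset.mul_sum, Finset.sum_eq_single a]
  · rw [smul_mul_smul_comm, (hQ.isProj a).isIdempotentElem.eq, Pi.mul_apply]
  · intro b _ hb
    rw [smul_mul_smul_comm, hQ.orthogonal a b hb.symm, smul_zero]
  · simp

theorem IsPVM.pvmSum_conjTranspose {Q : κ → Matrix ι ι ℂ} (hQ : IsPVM Q) (c : κ → ℂ) :
    (pvmSum Q c)ᴴ = pvmSum Q (star c) := by
  rw [pvmSum, pvmSum, Matrix.conjTranspose_sum]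
  refine Finset.sum_congr rfl fun a _ => ?_
  rw [Matrix.conjTranspose_smul, ← Matrix.star_eq_conjTranspose (Q a),
    (hQ.isProj a).isSelfAdjoint.star_eq, Pi.star_apply]

theorem IsPVM.norm_pvmSum_le {Q : κ → Matrix ι ι ℂ} (hQ : IsPVM Q) {c : κ → ℂ} {M : ℝ}
    (hM : 0 ≤ M) (hc : ∀ a, ‖c a‖ ≤ M) : ‖pvmSum Q c‖ ≤ M := by
  have hs : ∀ a, (Q a)ᴴ = Q a := fun a => (hQ.isProj a).isSelfAdjoint.star_eq
  have hm : ∀ a, Q a * Q a = Q a := fun a => (hQ.isProj a).isIdempotentElem.eq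
  have h := Matrix.norm_sum_mul_mul_conjTranspose_le (B := Q) (Z := fun a => c a • 1) hM
    (by simp_rw [hs, hm, hQ.sum_eq_one])
    (fun a => by
      rw [norm_smul]
      nlinarith [hc a, Matrix.norm_one_le (ι := ι), norm_nonneg (c a),
        norm_nonneg (1 : Matrix ι ι ℂ)])
  simpa [hs, hm, pvmSum] using h

theorem IsPVM.pvmSum_mem_unitaryGroup {Q : κ → Matrix ι ι ℂ} (hQ : IsPVM Q) {c : κ → ℂ}
    (hc : ∀ a, ‖c a‖ = 1) : pvmSum Q c ∈ Matrix.unitaryGroup ι ℂ := by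
  rw [Matrix.mem_unitaryGroup_iff, Matrix.star_eq_conjTranspose, hQ.pvmSum_conjTranspose,
    ← hQ.pvmSum_mul, ← hQ.pvmSum_one]
  congr 1
  ext a
  simp [Complex.mul_conj, Complex.normSq_eq_norm_sq, hc]

theorem IsPVM.pvmSum_polynomial {Q : κ → Matrix ι ι ℂ} (hQ : IsPVM Q) (c : κ → ℝ)
    (p : Polynomial ℝ) :
    Polynomial.aeval (pvmSum Q fun a => (c a : ℂ)) p = pvmSum Q fun a => ((p.eval (c a) : ℝ) : ℂ) := by
  induction p using Polynomial.induction_on' with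
  | add p q hp hq =>
    rw [map_add, hp, hq, ← pvmSum_add]
    congr 1; ext a; simp
  | monomial n r =>
    have hpow : ∀ n : ℕ, (pvmSum Q fun a => (c a : ℂ)) ^ n
        = pvmSum Q fun a => ((c a ^ n : ℝ) : ℂ) := by
      intro n
      induction n with
      | zero => simpa using (hQ.pvmSum_const 1).symm
      | succ n ih =>
        rw [pow_succ, ih, ← hQ.pvmSum_mul]
        congr 1; ext a; simp [pow_succ]
    rw [Polynomial.aeval_monomial, hpow, ← Algebra.smul_def, ← algebraMap_smul ℂ r, ← pvmSum_smul]
    congr 1; ext a; simp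

theorem IsPVM.cfc_pvmSum {Q : κ → Matrix ι ι ℂ} (hQ : IsPVM Q) (f : ℝ → ℝ) (c : κ → ℝ) :
    cfc f (pvmSum Q fun a => (c a : ℂ)) = pvmSum Q fun a => (f (c a) : ℂ) := by
  classical
  set H := pvmSum Q fun a => (c a : ℂ) with hH
  have hsa : IsSelfAdjoint H := by
    rw [IsSelfAdjoint, Matrix.star_eq_conjTranspose, hH, hQ.pvmSum_conjTranspose]
    congr 1; ext a; simp
  have hfin : (spectrum ℝ H).Finite := Matrix.finite_real_spectrum
  -- The values of c are added as nodes because some `Q a` may vanish, and then `c a` need not lie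
  -- in the spectrum.
  set s : Finset ℝ := hfin.toFinset ∪ Finset.univ.image c with hs
  set p := Lagrange.interpolate s id f with hp
  have hpe : ∀ x ∈ s, p.eval x = f x := fun x hx => by
    exact Lagrange.eval_interpolate_at_node (s := s) (v := id) f
      Function.injective_id.injOn hx
  have h1 : cfc f H = cfc p.eval H := cfc_congr fun x hx => by
    exact (hpe x (by simp [hs, hx])).symm
  rw [h1, cfc_polynomial p H hsa, hH, hQ.pvmSum_polynomial]
  congr 1; ext a
  rw [hpe (c a) (by simp [hs])]

/-- No invertibility is needed: where c vanishes both sides have coefficient 0. -/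
theorem IsPVM.polar_pvmSum {Q : κ → Matrix ι ι ℂ} (hQ : IsPVM Q) (c : κ → ℂ) :
    polar (pvmSum Q c) = pvmSum Q fun a => c a * ((‖c a‖⁻¹ : ℝ) : ℂ) := by
  rw [polar, hQ.pvmSum_conjTranspose, ← hQ.pvmSum_mul]
  have : star c * c = fun a => ((‖c a‖ ^ 2 : ℝ) : ℂ) := by
    ext a
    simp [Complex.conj_mul']
  rw [this, hQ.cfc_pvmSum, ← hQ.pvmSum_mul]
  congr 1; ext a
  simp [Real.sqrt_sq (norm_nonneg _)]

/-! ### The polar part of an invertible matrix -/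

/-- Both claims are scalar statements on the positive spectrum of TᴴT: there t (√t)⁻² = 1, and (1 -
√t)² ≤ (1 - t)² because 1 - t = (1 - √t)(1 + √t). -/
theorem polar_mem_unitaryGroup_and_norm_sub_le {T : Matrix ι ι ℂ} (hT : IsUnit T) :
    polar T ∈ Matrix.unitaryGroup ι ℂ ∧ ‖polar T - T‖ ≤ ‖1 - Tᴴ * T‖ := by
  set H := Tᴴ * T with hH
  have hsa : IsSelfAdjoint H := by
    rw [IsSelfAdjoint, Matrix.star_eq_conjTranspose, hH, Matrix.conjTranspose_mul,
      Matrix.conjTranspose_conjTranspose]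
  have hpd : H.PosDef := Matrix.PosDef.conjTranspose_mul_self T
    (Matrix.mulVec_injective_of_isUnit hT)
  have hpos : ∀ x ∈ spectrum ℝ H, 0 < x := by
    intro x hx
    rw [hpd.isHermitian.spectrum_real_eq_range_eigenvalues] at hx
    obtain ⟨i, rfl⟩ := hx
    exact hpd.eigenvalues_pos i
  have hcont : ∀ f : ℝ → ℝ, ContinuousOn f (spectrum ℝ H) := fun f =>
    (Matrix.finite_real_spectrum (A := H)).continuousOn f
  set R := cfc (fun t : ℝ => (√t)⁻¹) H with hR
  have hRs : Rᴴ = R := (IsSelfAdjoint.cfc (f := fun t : ℝ => (√t)⁻¹) (a := H)).star_eq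
  have hid : cfc (fun t : ℝ => t) H = H := cfc_id' ℝ H
  have hP : polar T = T * R := rfl
  constructor
  · rw [Matrix.mem_unitaryGroup_iff', hP, Matrix.star_eq_conjTranspose, Matrix.conjTranspose_mul,
      hRs, Matrix.mul_assoc, ← Matrix.mul_assoc Tᴴ, ← hH]
    conv_lhs => rw [← hid, hR]
    rw [← cfc_mul _ _ _ (hcont _) (hcont _), ← cfc_mul _ _ _ (hcont _) (hcont _)]
    rw [← cfc_one ℝ H]
    refine cfc_congr fun x hx => ?_
    have h0 := hpos x hx
    have h1 : √x * √x = x := Real.mul_self_sqrt h0.le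
    have h2 : √x ≠ 0 := (Real.sqrt_pos.2 h0).ne'
    simp only [Pi.one_apply]
    nth_rewrite 2 [← h1]
    field_simp
  · have h1 : (polar T - T)ᴴ * (polar T - T) = cfc (fun t : ℝ => (1 - √t) ^ 2) H := by
      have : (polar T - T)ᴴ * (polar T - T) = (R - 1) * (H * (R - 1)) := by
        rw [hP, Matrix.conjTranspose_sub, Matrix.conjTranspose_mul, hRs, hH]
        noncomm_ring
      rw [this]
      have hR1 : R - 1 = cfc (fun t : ℝ => (√t)⁻¹ - 1) H := by
        rw [cfc_sub _ _ _ (hcont _) (hcont _), cfc_const_one ℝ H]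
      rw [hR1]
      nth_rewrite 2 [← hid]
      rw [← cfc_mul _ _ _ (hcont _) (hcont _), ← cfc_mul _ _ _ (hcont _) (hcont _)]
      refine cfc_congr fun x hx => ?_
      have h0 := hpos x hx
      have h1 : √x * √x = x := Real.mul_self_sqrt h0.le
      have h2 : √x ≠ 0 := (Real.sqrt_pos.2 h0).ne'
      nth_rewrite 2 [← h1]
      field_simp
    have h2 : 1 - H = cfc (fun t : ℝ => 1 - t) H := by
      rw [cfc_sub _ _ _ (hcont _) (hcont _), cfc_const_one ℝ H, hid]
    have h3 : ‖(polar T - T)ᴴ * (polar T - T)‖ ≤ ‖1 - H‖ ^ 2 := by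
      rw [h1]
      refine norm_cfc_le (by positivity) fun x hx => ?_
      have h4 : ‖1 - x‖ ≤ ‖1 - H‖ := by
        rw [h2]
        exact norm_apply_le_norm_cfc (fun t : ℝ => 1 - t) H hx (hcont _)
      rw [Real.norm_eq_abs, abs_pow, ]
      refine pow_le_pow_left₀ (abs_nonneg _) (le_trans ?_ h4) 2
      have h5 : 1 - x = (1 - √x) * (1 + √x) := by
        nth_rewrite 1 [← Real.mul_self_sqrt (hpos x hx).le]; ring
      rw [h5, norm_mul, Real.norm_eq_abs, Real.norm_eq_abs (1 + √x),
        abs_of_nonneg (by positivity : 0 ≤ 1 + √x)]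
      nlinarith [abs_nonneg (1 - √x), Real.sqrt_nonneg x]
    rw [Matrix.l2_opNorm_conjTranspose_mul_self, ← pow_two] at h3
    exact (pow_le_pow_iff_left₀ (norm_nonneg _) (norm_nonneg _) two_ne_zero).1 h3

end Matrices

/-! ### Window functions -/

/-- Take F = cos²(πφ/2), where φ is even, equals 1 for |x| ≥ 1, and satisfies φ(x - 1) = 1 - φ(x) on
[0, 1]. Shifting by 1 turns the cosine into a sine. As 0 ≤ φ ≤ 1 the cosine is nonnegative, so it is
itself √F and hence smooth. -/
theorem exists_isWindow : ∃ F : ℝ → ℝ, IsWindow F := by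
  set φ : ℝ → ℝ := fun x => Real.smoothTransition x + Real.smoothTransition (-x) with hφ
  have h01 : ∀ x, 0 ≤ φ x ∧ φ x ≤ 1 := by
    intro x
    rcases le_total x 0 with h | h
    · simp only [hφ, Real.smoothTransition.zero_of_nonpos h, zero_add]
      exact ⟨Real.smoothTransition.nonneg _, Real.smoothTransition.le_one _⟩
    · simp only [hφ, Real.smoothTransition.zero_of_nonpos (neg_nonpos.2 h), add_zero]
      exact ⟨Real.smoothTransition.nonneg _, Real.smoothTransition.le_one _⟩
  have hone : ∀ x, 1 ≤ |x| → φ x = 1 := by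
    intro x hx
    rcases le_abs.1 hx with h | h
    · simp only [hφ, Real.smoothTransition.one_of_one_le h,
        Real.smoothTransition.zero_of_nonpos (by linarith : -x ≤ 0), add_zero]
    · simp only [hφ, Real.smoothTransition.one_of_one_le h,
        Real.smoothTransition.zero_of_nonpos (by linarith : x ≤ 0), zero_add]
  have heven : ∀ x, φ (-x) = φ x := fun x => by simp only [hφ, neg_neg, add_comm]
  have hsym : ∀ x, 0 ≤ x → x ≤ 1 → φ (x - 1) = 1 - φ x := by
    intro x h0 h1
    have h2 := Real.smoothTransition.pos_denom x
    have h3 : φ (x - 1) = Real.smoothTransition (1 - x) := by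
      simp only [hφ, Real.smoothTransition.zero_of_nonpos (by linarith : x - 1 ≤ 0), zero_add,
        neg_sub]
    have h4 : φ x = Real.smoothTransition x := by
      simp only [hφ, Real.smoothTransition.zero_of_nonpos (by linarith : -x ≤ 0), add_zero]
    rw [h3, h4, Real.smoothTransition, Real.smoothTransition, sub_sub_cancel,
      add_comm (expNegInvGlue (1 - x))]
    field_simp
    ring
  have hcos : ∀ x, 0 ≤ Real.cos (Real.pi / 2 * φ x) := fun x =>
    Real.cos_nonneg_of_mem_Icc ⟨by nlinarith [Real.pi_pos, h01 x], by nlinarith [Real.pi_pos, h01 x]⟩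
  have hzero : ∀ x, 1 ≤ |x| → Real.cos (Real.pi / 2 * φ x) ^ 2 = 0 := fun x hx => by
    rw [hone x hx]; simp
  have hsum : ∀ x, 0 ≤ x → x ≤ 1 → Real.cos (Real.pi / 2 * φ (x - 1)) ^ 2
      + Real.cos (Real.pi / 2 * φ x) ^ 2 + Real.cos (Real.pi / 2 * φ (x + 1)) ^ 2 = 1 := by
    intro x h0 h1
    rw [hzero (x + 1) (by rw [abs_of_nonneg] <;> linarith), hsym x h0 h1, mul_sub, mul_one,
      Real.cos_pi_div_two_sub, add_zero, Real.sin_sq_add_cos_sq]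
  refine ⟨fun x => Real.cos (Real.pi / 2 * φ x) ^ 2, hzero, fun x hx => ?_, fun x => sq_nonneg _, ?_⟩
  · rcases abs_le.1 hx with ⟨h1, h2⟩
    rcases le_total 0 x with h | h
    · exact hsum x h h2
    · have := hsum (-x) (by linarith) (by linarith)
      rw [show -x - 1 = -(x + 1) by ring, show -x + 1 = -(x - 1) by ring, heven, heven, heven] at this
      linarith
  · simp only [Real.sqrt_sq (hcos _)]
    have h1 : ContDiff ℝ ∞ φ :=
      Real.smoothTransition.contDiff.add (Real.smoothTransition.contDiff.comp contDiff_neg)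
    exact Real.contDiff_cos.comp (contDiff_const.mul h1)

theorem abs_div_le_ceil {Δ x : ℝ} (hΔ : 0 < Δ) (hx : |x| ≤ 1) : |x / Δ| ≤ (⌈1 / Δ⌉ : ℤ) := by
  rw [abs_div, abs_of_pos hΔ]
  exact (div_le_div_of_nonneg_right hx hΔ.le).trans (Int.le_ceil _)

namespace IsWindow

variable {F : ℝ → ℝ} (hF : IsWindow F)
include hF

theorem le_one (x : ℝ) : F x ≤ 1 := by
  rcases le_total |x| 1 with h | h
  · linarith [hF.sum_eq_one x h, hF.nonneg (x - 1), hF.nonneg (x + 1)]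
  · rw [hF.eq_zero x h]; exact zero_le_one

theorem sum_Icc_eq_one {M : ℤ} {s : ℝ} (hs : |s| ≤ M) :
    ∑ m ∈ Finset.Icc (-M) M, F (s - m) = 1 := by
  obtain ⟨h1, h2⟩ := abs_le.1 hs
  set k := ⌊s⌋ with hk
  have hk1 : -M ≤ k := Int.le_floor.2 (by push_cast; exact h1)
  have hk2 : k ≤ M := by exact_mod_cast (Int.floor_le s).trans h2
  have hfl := Int.floor_le s
  have hfl2 := Int.lt_floor_add_one s
  rw [← hk] at hfl hfl2
  -- One label is added at each end, where F vanishes, so that k - 1, k, k + 1 are all in range even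
  -- for k = ±M.
  have hA : ∑ m ∈ Finset.Icc (-M) M, F (s - m) = ∑ m ∈ Finset.Icc (-(M + 1)) (M + 1), F (s - m) := by
    refine Finset.sum_subset (Finset.Icc_subset_Icc (by omega) (by omega)) fun m hm hm' => ?_
    refine hF.eq_zero _ (le_abs.2 ?_)
    simp only [Finset.mem_Icc] at hm hm'
    rcases (by omega : M + 1 ≤ m ∨ m ≤ -(M + 1)) with h | h
    · right
      have : (M : ℝ) + 1 ≤ m := by exact_mod_cast h
      linarith
    · left
      have : (m : ℝ) ≤ -(M + 1) := by exact_mod_cast h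
      linarith
  have hB : ∑ m ∈ ({k - 1, k, k + 1} : Finset ℤ), F (s - m)
      = ∑ m ∈ Finset.Icc (-(M + 1)) (M + 1), F (s - m) := by
    refine Finset.sum_subset (fun m hm => ?_) fun m hm hm' => ?_
    · simp only [Finset.mem_insert, Finset.mem_singleton] at hm
      simp only [Finset.mem_Icc]; omega
    · refine hF.eq_zero _ (le_abs.2 ?_)
      simp only [Finset.mem_insert, Finset.mem_singleton] at hm'
      rcases (by omega : k + 2 ≤ m ∨ m ≤ k - 2) with h | h
      · right
        have : (k : ℝ) + 2 ≤ m := by exact_mod_cast h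
        linarith
      · left
        have : (m : ℝ) ≤ k - 2 := by exact_mod_cast h
        linarith
  rw [hA, ← hB, Finset.sum_insert, Finset.sum_insert, Finset.sum_singleton]
  · have := hF.sum_eq_one (s - k) (by rw [abs_of_nonneg] <;> linarith)
    push_cast
    rw [show s - (k - 1) = s - k + 1 by ring, show s - (k + 1) = s - (k : ℝ) - 1 by ring]
    linarith
  · simp
  · simp only [Finset.mem_insert, Finset.mem_singleton]; omega

theorem sum_label_eq_one {Δ x : ℝ} (hΔ : 0 < Δ) (hx : |x| ≤ 1) :
    ∑ m : Label Δ, F (x / Δ - (m : ℤ)) = 1 := by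
  rw [Finset.sum_coe_sort (Finset.Icc (-⌈1 / Δ⌉) ⌈1 / Δ⌉) (fun m : ℤ => F (x / Δ - m))]
  exact hF.sum_Icc_eq_one (abs_div_le_ceil hΔ hx)

theorem hasCompactSupport_sqrt : HasCompactSupport fun x => √(F x) := by
  refine HasCompactSupport.intro (isCompact_Icc (a := (-1 : ℝ)) (b := 1)) fun x hx => ?_
  rw [hF.eq_zero x, Real.sqrt_zero]
  by_contra h
  exact hx (abs_le.1 (not_le.1 h).le)

/-- The first moment of the window is close to the argument. -/
theorem abs_sum_label_sub_le {Δ x : ℝ} (hΔ : 0 < Δ) (hx : |x| ≤ 1) :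
    |∑ m : Label Δ, ((m : ℤ) * Δ) * F (x / Δ - (m : ℤ)) - x| ≤ Δ := by
  have h := hF.sum_label_eq_one hΔ hx
  have : ∑ m : Label Δ, ((m : ℤ) * Δ) * F (x / Δ - (m : ℤ)) - x
      = ∑ m : Label Δ, (((m : ℤ) * Δ) - x) * F (x / Δ - (m : ℤ)) := by
    simp_rw [sub_mul]
    rw [Finset.sum_sub_distrib, ← Finset.mul_sum, h, mul_one]
  rw [this]
  calc _ ≤ ∑ m : Label Δ, |(((m : ℤ) * Δ) - x) * F (x / Δ - (m : ℤ))| :=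
        Finset.abs_sum_le_sum_abs _ _
    _ ≤ ∑ m : Label Δ, Δ * F (x / Δ - (m : ℤ)) := by
        refine Finset.sum_le_sum fun m _ => ?_
        rw [abs_mul, abs_of_nonneg (hF.nonneg _)]
        by_cases hm : 1 ≤ |x / Δ - (m : ℤ)|
        · rw [hF.eq_zero _ hm]; simp
        · refine mul_le_mul_of_nonneg_right ?_ (hF.nonneg _)
          have : (m : ℤ) * Δ - x = -(Δ * (x / Δ - (m : ℤ))) := by field_simp; ring
          rw [this, abs_neg, abs_mul, abs_of_pos hΔ]
          nlinarith
    _ = Δ := by rw [← Finset.mul_sum, h, mul_one]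

/-- The second moment of the window is close to the square of the argument. -/
theorem exists_abs_sum_label_sq_sub_le : ∃ C : ℝ, 0 ≤ C ∧ ∀ Δ x : ℝ, 0 < Δ → |x| ≤ 1 →
    |∑ m : Label Δ, ((m : ℤ) * Δ) ^ 2 * F (x / Δ - (m : ℤ)) - x ^ 2| ≤ C * Δ := by
  obtain ⟨L, hL⟩ := (hF.smooth_sqrt.of_le (by simp) : ContDiff ℝ 1 _).lipschitzWith_of_hasCompactSupport
    hF.hasCompactSupport_sqrt one_ne_zero
  -- F ≤ √F, and √F is Lipschitz and vanishes at ±1. This serves wide windows, where the outcome ±Δ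
  -- has square Δ² and must have weight O(1/Δ).
  have hend : ∀ y e : ℝ, |e| = 1 → F y ≤ L * |y - e| := by
    intro y e he
    have h1 := hL.dist_le_mul y e
    simp only [Real.dist_eq, hF.eq_zero e he.ge, Real.sqrt_zero, sub_zero] at h1
    have h2 : √(F y) ≤ 1 := Real.sqrt_le_one.2 (hF.le_one y)
    have h3 := Real.mul_self_sqrt (hF.nonneg y)
    rw [abs_of_nonneg (Real.sqrt_nonneg _)] at h1
    nlinarith [Real.sqrt_nonneg (F y)]
  refine ⟨3 + (1 + 2 * L), by positivity, fun Δ x hΔ hx => ?_⟩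
  have h := hF.sum_label_eq_one hΔ hx
  rcases le_total Δ 1 with h1 | h1
  · have : ∑ m : Label Δ, ((m : ℤ) * Δ) ^ 2 * F (x / Δ - (m : ℤ)) - x ^ 2
        = ∑ m : Label Δ, (((m : ℤ) * Δ) ^ 2 - x ^ 2) * F (x / Δ - (m : ℤ)) := by
      simp_rw [sub_mul]
      rw [Finset.sum_sub_distrib, ← Finset.mul_sum, h, mul_one]
    rw [this]
    calc _ ≤ ∑ m : Label Δ, |(((m : ℤ) * Δ) ^ 2 - x ^ 2) * F (x / Δ - (m : ℤ))| :=
          Finset.abs_sum_le_sum_abs _ _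
      _ ≤ ∑ m : Label Δ, (3 * Δ) * F (x / Δ - (m : ℤ)) := by
          refine Finset.sum_le_sum fun m _ => ?_
          rw [abs_mul, abs_of_nonneg (hF.nonneg _)]
          by_cases hm : 1 ≤ |x / Δ - (m : ℤ)|
          · rw [hF.eq_zero _ hm]; simp
          · refine mul_le_mul_of_nonneg_right ?_ (hF.nonneg _)
            have h2 : (m : ℤ) * Δ - x = -(Δ * (x / Δ - (m : ℤ))) := by field_simp; ring
            have h3 : |(m : ℤ) * Δ - x| ≤ Δ := by
              rw [h2, abs_neg, abs_mul, abs_of_pos hΔ]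
              nlinarith
            have h4 : ((m : ℤ) * Δ) ^ 2 - x ^ 2
                = ((m : ℤ) * Δ - x) * (((m : ℤ) * Δ - x) + 2 * x) := by ring
            rw [h4, abs_mul]
            have h5 : |((m : ℤ) * Δ - x) + 2 * x| ≤ 3 := by
              refine (abs_add_le _ _).trans ?_
              rw [abs_mul, abs_two]; linarith
            calc _ ≤ Δ * 3 := by gcongr
              _ = _ := by ring
      _ = 3 * Δ := by rw [← Finset.mul_sum, h, mul_one]
      _ ≤ _ := by have : (0 : ℝ) ≤ L := L.2; nlinarith
  · have hM : ⌈1 / Δ⌉ = 1 := by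
      rw [Int.ceil_eq_iff]
      refine ⟨by simpa using hΔ, ?_⟩
      rw [div_le_iff₀ hΔ]; simpa using h1
    rw [Finset.sum_coe_sort (Finset.Icc (-⌈1 / Δ⌉) ⌈1 / Δ⌉)
      (fun m : ℤ => ((m : ℝ) * Δ) ^ 2 * F (x / Δ - m)), hM]
    have hI : Finset.Icc (-1 : ℤ) 1 = {-1, 0, 1} := by decide
    rw [hI, Finset.sum_insert (by decide), Finset.sum_insert (by decide), Finset.sum_singleton]
    have hxd : |x / Δ| ≤ 1 / Δ := by
      rw [abs_div, abs_of_pos hΔ]; gcongr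
    have e1 := hend (x / Δ - (-1 : ℤ)) 1 (by simp)
    have e2 := hend (x / Δ - (1 : ℤ)) (-1) (by simp)
    push_cast at e1 e2 ⊢
    rw [show x / Δ - -1 - 1 = x / Δ by ring] at e1
    rw [show x / Δ - 1 - -1 = x / Δ by ring] at e2
    have hL0 : (0 : ℝ) ≤ L := L.2
    have e3 : ∀ y, F y ≤ L * |x / Δ| → Δ ^ 2 * F y ≤ L * Δ := by
      intro y hy
      calc Δ ^ 2 * F y ≤ Δ ^ 2 * (L * (1 / Δ)) := by gcongr; exact hy.trans (by gcongr)
        _ = L * Δ := by field_simp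
    have e4 := e3 _ e1
    have e5 := e3 _ e2
    have e6 : x ^ 2 ≤ 1 := by rw [← sq_abs]; nlinarith [abs_nonneg x]
    have e7 := mul_nonneg (sq_nonneg Δ) (hF.nonneg (x / Δ - -1))
    have e8 := mul_nonneg (sq_nonneg Δ) (hF.nonneg (x / Δ - 1))
    rw [abs_le]
    constructor <;> nlinarith [sq_nonneg x]

end IsWindow

/-! ### Fourier expansion of the modulated window sums -/

open scoped FourierTransform SchwartzMap in
-- Poisson summation for h(u) = e^(-2πiθu) √(F u), multiplied by e^(2πiθs), gives the coefficients
-- c_k = f̂(k + θ), with f = √F. The point is that C does not depend on θ, and that the weight 1 +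
-- |2π(k + θ)| controls the derivative as well as the size.
theorem IsWindow.exists_fourier_expansion {F : ℝ → ℝ} (hF : IsWindow F) :
    ∃ C : ℝ, 0 ≤ C ∧ ∀ θ : ℝ, 0 ≤ θ → θ ≤ 1 → ∃ (c : ℤ → ℂ) (b : ℤ → ℝ), HasSum b C ∧
      (∀ k, ‖c k‖ * (1 + |2 * Real.pi * (k + θ)|) ≤ b k) ∧
      ∀ s : ℝ, HasSum (fun k : ℤ => c k * Complex.exp (((2 * Real.pi * (k + θ) * s : ℝ) : ℂ) * Complex.I))
        (∑' m : ℤ, Complex.exp (((2 * Real.pi * θ * m : ℝ) : ℂ) * Complex.I) * (√(F (s - m)) : ℂ)) := by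
  have hfs : ContDiff ℝ ∞ fun x => (√(F x) : ℂ) := Complex.ofRealCLM.contDiff.comp hF.smooth_sqrt
  have hfc : HasCompactSupport fun x => (√(F x) : ℂ) :=
    hF.hasCompactSupport_sqrt.comp_left Complex.ofReal_zero
  set f : 𝓢(ℝ, ℂ) := hfc.toSchwartzMap hfs with hf
  have hfv : ∀ x, f x = (√(F x) : ℂ) := fun x => rfl
  -- Cubic decay of the Fourier transform: one power pays for the weight, two for summability over
  -- k.
  set D : ℝ := 2 ^ 3 * ((Finset.Iic ((3, 0) : ℕ × ℕ)).sup fun m => SchwartzMap.seminorm ℝ m.1 m.2) (𝓕 f)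
    with hD
  have hD' : ∀ ξ : ℝ, (1 + |ξ|) ^ 3 * ‖(𝓕 f) ξ‖ ≤ D := fun ξ => by
    simpa using SchwartzMap.one_add_le_sup_seminorm_apply (𝕜 := ℝ) (m := (3, 0)) (k := 3) (n := 0)
      le_rfl le_rfl (𝓕 f) ξ
  have hD0 : 0 ≤ D := le_trans (by positivity) (hD' 0)
  have hsum : Summable fun k : ℤ => 1 / (1 + (k : ℝ) ^ 2) := by
    have h1 : Summable fun k : ℤ => 1 / (k : ℝ) ^ 2 + if k = 0 then (1 : ℝ) else 0 :=
      (Real.summable_one_div_int_pow.2 one_lt_two).add (hasSum_ite_eq 0 1).summable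
    refine h1.of_nonneg_of_le (fun k => by positivity) fun k => ?_
    by_cases hk : k = 0
    · simp [hk]
    · have : (k : ℝ) ≠ 0 := by exact_mod_cast hk
      rw [if_neg hk, add_zero]
      gcongr
      linarith
  refine ⟨∑' k : ℤ, 14 * D * (1 / (1 + (k : ℝ) ^ 2)), tsum_nonneg fun k => by positivity,
    fun θ h0 h1 => ⟨fun k => (𝓕 f) (k + θ), fun k => 14 * D * (1 / (1 + (k : ℝ) ^ 2)),
      (hsum.mul_left _).hasSum, fun k => ?_, fun s => ?_⟩⟩
  · set ξ : ℝ := k + θ with hξ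
    have h2 := hD' ξ
    have hk : |(k : ℝ)| ≤ 1 + |ξ| := by
      have : (k : ℝ) = ξ - θ := by rw [hξ]; ring
      rw [this]
      refine (abs_sub _ _).trans ?_
      rw [abs_of_nonneg h0]; linarith
    have hk2 : 1 + (k : ℝ) ^ 2 ≤ 2 * (1 + |ξ|) ^ 2 := by
      rw [← sq_abs]; nlinarith [abs_nonneg ξ, abs_nonneg (k : ℝ)]
    have hpi : 1 + |2 * Real.pi * ξ| ≤ 7 * (1 + |ξ|) := by
      rw [abs_mul, abs_of_pos Real.two_pi_pos]
      nlinarith [Real.pi_lt_d2, abs_nonneg ξ]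
    change ‖(𝓕 f) ξ‖ * (1 + |2 * Real.pi * ξ|) ≤ 14 * D * (1 / (1 + (k : ℝ) ^ 2))
    rw [mul_one_div, le_div_iff₀ (by positivity)]
    calc ‖(𝓕 f) ξ‖ * (1 + |2 * Real.pi * ξ|) * (1 + (k : ℝ) ^ 2)
        ≤ ‖(𝓕 f) ξ‖ * (7 * (1 + |ξ|)) * (2 * (1 + |ξ|) ^ 2) := by gcongr
      _ = 14 * ((1 + |ξ|) ^ 3 * ‖(𝓕 f) ξ‖) := by ring
      _ ≤ 14 * D := by gcongr
  · have hmod : ContDiff ℝ ∞ fun u : ℝ =>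
        Complex.exp (((-(2 * Real.pi * θ) * u : ℝ) : ℂ) * Complex.I) * (√(F u) : ℂ) := by
      refine ContDiff.mul ?_ hfs
      refine ContDiff.cexp (ContDiff.mul ?_ contDiff_const)
      exact Complex.ofRealCLM.contDiff.comp (contDiff_const.mul contDiff_id)
    set h : 𝓢(ℝ, ℂ) := hfc.mul_left.toSchwartzMap hmod with hh
    have hhv : ∀ u, h u = Complex.exp (((-(2 * Real.pi * θ) * u : ℝ) : ℂ) * Complex.I) * (√(F u) : ℂ) :=
      fun u => rfl
    have hFh : ∀ k : ℝ, (𝓕 h) k = (𝓕 f) (k + θ) := by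
      intro k
      rw [SchwartzMap.fourier_coe, SchwartzMap.fourier_coe, Real.fourier_real_eq_integral_exp_smul,
        Real.fourier_real_eq_integral_exp_smul]
      refine MeasureTheory.integral_congr_ae (.of_forall fun u => ?_)
      simp only [hhv, hfv, smul_eq_mul]
      rw [← mul_assoc, ← Complex.exp_add]
      congr 2
      push_cast; ring
    have hpo := SchwartzMap.tsum_eq_tsum_fourier h s
    have hsm : Summable fun k : ℤ => (𝓕 f) (k + θ) *
        Complex.exp (((2 * Real.pi * (k + θ) * s : ℝ) : ℂ) * Complex.I) := by
      refine Summable.of_norm_bounded (hsum.mul_left (2 * D)) fun k => ?_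
      rw [norm_mul, Complex.norm_exp_ofReal_mul_I, mul_one, mul_one_div, le_div_iff₀ (by positivity)]
      set ξ : ℝ := k + θ with hξ
      have hk : |(k : ℝ)| ≤ 1 + |ξ| := by
        have : (k : ℝ) = ξ - θ := by rw [hξ]; ring
        rw [this]
        refine (abs_sub _ _).trans ?_
        rw [abs_of_nonneg h0]; linarith
      have hk2 : 1 + (k : ℝ) ^ 2 ≤ 2 * (1 + |ξ|) ^ 3 := by
        rw [← sq_abs]; nlinarith [abs_nonneg ξ, abs_nonneg (k : ℝ), pow_nonneg (abs_nonneg ξ) 3,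
          pow_nonneg (abs_nonneg ξ) 2]
      calc ‖(𝓕 f) ξ‖ * (1 + (k : ℝ) ^ 2) ≤ ‖(𝓕 f) ξ‖ * (2 * (1 + |ξ|) ^ 3) := by gcongr
        _ = 2 * ((1 + |ξ|) ^ 3 * ‖(𝓕 f) ξ‖) := by ring
        _ ≤ 2 * D := by gcongr; exact hD' ξ
    have hval : ∑' k : ℤ, (𝓕 f) (k + θ) *
        Complex.exp (((2 * Real.pi * (k + θ) * s : ℝ) : ℂ) * Complex.I)
        = ∑' m : ℤ, Complex.exp (((2 * Real.pi * θ * m : ℝ) : ℂ) * Complex.I) * (√(F (s - m)) : ℂ) := by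
      have e1 : ∀ k : ℤ, (𝓕 f) (k + θ) *
          Complex.exp (((2 * Real.pi * (k + θ) * s : ℝ) : ℂ) * Complex.I)
          = Complex.exp (((2 * Real.pi * θ * s : ℝ) : ℂ) * Complex.I) *
            ((𝓕 h) k * fourier k (s : UnitAddCircle)) := by
        intro k
        rw [hFh, fourier_coe_apply, mul_left_comm, ← Complex.exp_add]
        congr 2
        push_cast; ring
      simp_rw [e1]
      rw [tsum_mul_left, ← hpo, ← (Equiv.neg ℤ).tsum_eq, ← tsum_mul_left]
      refine tsum_congr fun m => ?_
      rw [hhv, ← mul_assoc, ← Complex.exp_add]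
      simp only [Equiv.neg_apply, Int.cast_neg]
      rw [← sub_eq_add_neg]
      congr 2
      push_cast; ring
    rw [← hval]
    exact hsm.hasSum

/-! ### Commutators with the unitary group generated by a Hermitian matrix -/

section Diagonal

variable {ι : Type*} [Fintype ι] [DecidableEq ι]

/-- The derivative of e(-t) Y e(t), with e(t) = exp(itD), is i e(-t) [Y, D] e(t), of norm at most
‖[Y, D]‖. The mean value inequality concludes. -/
theorem norm_commute_diagonal_exp_le (l : ι → ℝ) (Y : Matrix ι ι ℂ) (t : ℝ) :
    ‖Y * Matrix.diagonal (fun i => Complex.exp ((t * l i : ℝ) * Complex.I))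
      - Matrix.diagonal (fun i => Complex.exp ((t * l i : ℝ) * Complex.I)) * Y‖
      ≤ |t| * ‖Y * Matrix.diagonal (fun i => (l i : ℂ)) - Matrix.diagonal (fun i => (l i : ℂ)) * Y‖ := by
  set e : ℝ → Matrix ι ι ℂ := fun t =>
    Matrix.diagonal (fun i => Complex.exp ((t * l i : ℝ) * Complex.I)) with he
  set D : Matrix ι ι ℂ := Matrix.diagonal (fun i => (l i : ℂ)) with hD
  have hn : ∀ t, ‖e t‖ ≤ 1 := fun t => by
    rw [he, Matrix.l2_opNorm_diagonal]
    exact (pi_norm_le_iff_of_nonneg zero_le_one).2 fun i => (Complex.norm_exp_ofReal_mul_I _).le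
  have hinv : ∀ t, e t * e (-t) = 1 := fun t => by
    simp only [he, Matrix.diagonal_mul_diagonal, ← Complex.exp_add, ← Matrix.diagonal_one]
    congr 1; ext i
    rw [← Complex.exp_zero]; congr 1; push_cast; ring
  have hd : ∀ t, HasDerivAt e (Complex.I • (D * e t)) t := fun t => by
    have h1 : HasDerivAt (fun t : ℝ => fun i => Complex.exp ((t * l i : ℝ) * Complex.I))
        (fun i => Complex.I * (l i * Complex.exp ((t * l i : ℝ) * Complex.I))) t := by
      refine hasDerivAt_pi.2 fun i => ?_
      have h2 : HasDerivAt (fun t : ℝ => ((t * l i : ℝ) : ℂ) * Complex.I) ((l i : ℂ) * Complex.I) t := by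
        have := ((hasDerivAt_id t).mul_const (l i)).ofReal_comp.mul_const Complex.I
        simpa using this
      convert! h2.cexp using 1
      ring
    have h3 := (LinearMap.toContinuousLinearMap
      (Matrix.diagonalLinearMap ι ℝ ℂ)).hasFDerivAt.comp_hasDerivAt t h1
    convert! h3 using 1
    simp only [he, hD, Matrix.diagonal_mul_diagonal]
    rw [← Matrix.diagonal_smul]
    rfl
  have hcomm : ∀ t, D * e t = e t * D := fun t => by
    simp only [he, hD, Matrix.diagonal_mul_diagonal, mul_comm]
  have hd' : ∀ t, HasDerivAt (fun t => e (-t) * Y * e t)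
      (Complex.I • (e (-t) * (Y * D - D * Y) * e t)) t := fun t => by
    have h1 : HasDerivAt (fun t => e (-t)) (-(Complex.I • (D * e (-t)))) t := by
      simpa [Function.comp_def] using! (hd (-t)).scomp t (hasDerivAt_neg t)
    refine ((h1.mul_const Y).mul (hd t)).congr_deriv ?_
    rw [hcomm (-t)]
    simp only [smul_mul_assoc, mul_smul_comm, neg_mul, Matrix.mul_sub, Matrix.sub_mul, smul_sub,
      Matrix.mul_assoc]
    abel
  have hbd : ‖e (-t) * Y * e t - e (-0) * Y * e 0‖ ≤ ‖Y * D - D * Y‖ * ‖t - 0‖ := by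
    refine Convex.norm_image_sub_le_of_norm_hasDerivWithin_le (s := Set.univ)
      (f := fun t => e (-t) * Y * e t)
      (fun x _ => (hd' x).hasDerivWithinAt) (fun x _ => ?_) convex_univ trivial trivial
    rw [norm_smul, Complex.norm_I, one_mul]
    calc _ ≤ ‖e (-x)‖ * ‖Y * D - D * Y‖ * ‖e x‖ :=
          (norm_mul_le _ _).trans (by gcongr; exact norm_mul_le _ _)
      _ ≤ 1 * ‖Y * D - D * Y‖ * 1 := by gcongr <;> exact hn _
      _ = _ := by ring
  have h0 : e 0 = 1 := by simp [he]
  have hfin : Y * e t - e t * Y = e t * (e (-t) * Y * e t - e (-0) * Y * e 0) := by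
    rw [neg_zero, h0, Matrix.mul_sub, ← Matrix.mul_assoc, ← Matrix.mul_assoc, hinv]
    simp
  change ‖Y * e t - e t * Y‖ ≤ _
  rw [hfin]
  calc _ ≤ ‖e t‖ * ‖e (-t) * Y * e t - e (-0) * Y * e 0‖ := norm_mul_le _ _
    _ ≤ 1 * (‖Y * D - D * Y‖ * ‖t - 0‖) := by gcongr; exact hn t
    _ = _ := by rw [one_mul, sub_zero, Real.norm_eq_abs, mul_comm]

/-- A function with an absolutely convergent expansion in characters is operator Lipschitz. -/
theorem norm_diagonal_le_of_hasSum (l : ι → ℝ) (Y : Matrix ι ι ℂ) (g : ℝ → ℂ) (c : ℤ → ℂ)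
    (w b : ℤ → ℝ) {C R : ℝ} (hR : 0 < R) (hb : HasSum b C) (hcb : ∀ k, ‖c k‖ * (1 + |w k|) ≤ b k)
    (hg : ∀ i, HasSum (fun k => c k * Complex.exp ((w k * (l i / R) : ℝ) * Complex.I)) (g (l i))) :
    ‖(Matrix.diagonal fun i => g (l i) : Matrix ι ι ℂ)‖ ≤ C ∧
    ‖Y * Matrix.diagonal (fun i => g (l i)) - Matrix.diagonal (fun i => g (l i)) * Y‖
      ≤ C * (‖Y * Matrix.diagonal (fun i => (l i : ℂ)) - Matrix.diagonal (fun i => (l i : ℂ)) * Y‖ / R) := by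
  set K := ‖Y * Matrix.diagonal (fun i => (l i : ℂ)) - Matrix.diagonal (fun i => (l i : ℂ)) * Y‖ with hK
  have hc : ∀ k, ‖c k‖ ≤ b k ∧ ‖c k‖ * |w k| ≤ b k := fun k => by
    have h1 := hcb k
    rw [mul_add, mul_one] at h1
    have h2 : 0 ≤ ‖c k‖ * |w k| := by positivity
    exact ⟨by linarith, by linarith [norm_nonneg (c k)]⟩
  set G : Matrix ι ι ℂ := Matrix.diagonal fun i => g (l i) with hG
  set e : ℤ → Matrix ι ι ℂ := fun k =>
    Matrix.diagonal (fun i => Complex.exp (((w k / R) * l i : ℝ) * Complex.I)) with he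
  have hsum : HasSum (fun k => c k • e k) G := by
    have h1 : HasSum (fun k => fun i => c k * Complex.exp ((w k * (l i / R) : ℝ) * Complex.I))
        (fun i => g (l i)) := Pi.hasSum.2 hg
    have h2 := h1.mapL (LinearMap.toContinuousLinearMap (Matrix.diagonalLinearMap ι ℂ ℂ))
    convert! h2 using 2 with k
    simp only [he, ← Matrix.diagonal_smul]
    change _ = Matrix.diagonal _
    congr 1; ext i
    simp only [Pi.smul_apply, smul_eq_mul]
    congr 4; ring
  have hen : ∀ k, ‖e k‖ ≤ 1 := fun k => by
    rw [he, Matrix.l2_opNorm_diagonal]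
    exact (pi_norm_le_iff_of_nonneg zero_le_one).2 fun i => (Complex.norm_exp_ofReal_mul_I _).le
  constructor
  · rw [← hsum.tsum_eq]
    refine tsum_of_norm_bounded hb fun k => ?_
    rw [norm_smul]
    nlinarith [norm_nonneg (c k), hen k, hc k]
  · have h1 : HasSum (fun k => c k • (Y * e k - e k * Y)) (Y * G - G * Y) := by
      have := (hsum.mul_left Y).sub (hsum.mul_right Y)
      convert! this using 2 with k
      rw [smul_sub, mul_smul_comm, smul_mul_assoc]
    rw [← h1.tsum_eq]
    refine tsum_of_norm_bounded (hb.mul_right (K / R)) fun k => ?_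
    rw [norm_smul]
    calc ‖c k‖ * ‖Y * e k - e k * Y‖ ≤ ‖c k‖ * (|w k / R| * K) := by
          gcongr; exact norm_commute_diagonal_exp_le l Y (w k / R)
      _ = ‖c k‖ * |w k| * (K / R) := by rw [abs_div, abs_of_pos hR]; ring
      _ ≤ b k * (K / R) := by gcongr; exact (hc k).2

end Diagonal

/-! ### The soft measurement channel almost fixes matrices that almost commute -/

theorem sum_range_exp_eq {L : ℕ} (hL : 0 < L) {m m' : ℤ} (h : |m - m'| < L) :
    ∑ j ∈ Finset.range L, Complex.exp (((2 * Real.pi * (j / L) * m : ℝ) : ℂ) * Complex.I) *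
      star (Complex.exp (((2 * Real.pi * (j / L) * m' : ℝ) : ℂ) * Complex.I))
      = if m = m' then (L : ℂ) else 0 := by
  set ζ : ℂ := Complex.exp (2 * Real.pi * Complex.I / L) with hζ
  have hprim : IsPrimitiveRoot ζ L := Complex.isPrimitiveRoot_exp L hL.ne'
  have hterm : ∀ j : ℕ, Complex.exp (((2 * Real.pi * (j / L) * m : ℝ) : ℂ) * Complex.I) *
      star (Complex.exp (((2 * Real.pi * (j / L) * m' : ℝ) : ℂ) * Complex.I)) = (ζ ^ (m - m')) ^ j := by
    intro j
    rw [hζ, ← Complex.exp_int_mul, ← Complex.exp_nat_mul, Complex.star_def, ← Complex.exp_conj,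
      ← Complex.exp_add]
    congr 1
    rw [map_mul, Complex.conj_ofReal, Complex.conj_I]
    push_cast
    ring
  simp_rw [hterm]
  split_ifs with hm
  · simp [hm]
  · have h1 : ζ ^ (m - m') ≠ 1 := by
      rw [Ne, hprim.zpow_eq_one_iff_dvd]
      intro hd
      have := Int.eq_zero_of_abs_lt_dvd hd h
      omega
    rw [geom_sum_eq h1]
    have h2 : (ζ ^ (m - m')) ^ L = 1 := by
      rw [← zpow_natCast, ← zpow_mul, mul_comm, zpow_mul, zpow_natCast, hprim.pow_eq_one, one_zpow]
    rw [h2, sub_self, zero_div]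

/-- A channel as an average over modulated sums of its Kraus operators. -/
theorem sum_mul_mul_conjTranspose_eq_average {ι : Type*} [Fintype ι] {M : ℤ}
    {L : ℕ} (hL : 0 < L) (hML : 2 * M < L)
    (B : Finset.Icc (-M) M → Matrix ι ι ℂ) (X : Matrix ι ι ℂ) :
    (L : ℂ) • ∑ m, B m * X * (B m)ᴴ = ∑ j ∈ Finset.range L,
      (∑ m : Finset.Icc (-M) M,
        Complex.exp (((2 * Real.pi * (j / L) * (m : ℤ) : ℝ) : ℂ) * Complex.I) • B m) * X *
      (∑ m : Finset.Icc (-M) M,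
        Complex.exp (((2 * Real.pi * (j / L) * (m : ℤ) : ℝ) : ℂ) * Complex.I) • B m)ᴴ := by
  simp only [Matrix.conjTranspose_sum, Finset.sum_mul, Finset.mul_sum, Matrix.conjTranspose_smul,
    smul_mul_assoc, mul_smul_comm, Finset.smul_sum, smul_smul]
  rw [Finset.sum_comm]
  refine Finset.sum_congr rfl fun m _ => ?_
  rw [Finset.sum_comm]
  have h : ∀ m' : Finset.Icc (-M) M, ∑ j ∈ Finset.range L,
      (star (Complex.exp (((2 * Real.pi * (j / L) * (m : ℤ) : ℝ) : ℂ) * Complex.I)) *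
        Complex.exp (((2 * Real.pi * (j / L) * (m' : ℤ) : ℝ) : ℂ) * Complex.I)) • (B m' * X * (B m)ᴴ)
      = if m = m' then (L : ℂ) • (B m * X * (B m)ᴴ) else 0 := by
    intro m'
    rw [← Finset.sum_smul]
    simp_rw [mul_comm (star _)]
    have h1 := Finset.mem_Icc.1 m.2
    have h2 := Finset.mem_Icc.1 m'.2
    -- Two labels differ by at most 2M < L, so distinct labels are distinct modulo L and the cross
    -- terms cancel.
    rw [sum_range_exp_eq hL (m := m') (m' := m) (by rw [abs_lt]; constructor <;> linarith)]
    by_cases hm : m = m'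
    · simp [hm]
    · rw [if_neg hm, if_neg fun h => hm (Subtype.ext h.symm), zero_smul]
  simp only [h, Finset.sum_ite_eq, Finset.mem_univ, if_true]

theorem softFactor_conjTranspose {N : ℕ} (F : ℝ → ℝ) (Δ : ℝ) (X : Matrix (Fin N) (Fin N) ℂ) (m : ℤ) :
    (softFactor F Δ X m)ᴴ = softFactor F Δ X m :=
  (IsSelfAdjoint.cfc (f := fun x : ℝ => √(F (x / Δ - m))) (a := X)).star_eq

theorem Matrix.IsHermitian.abs_le_of_mem_spectrum {N : ℕ} {H : Matrix (Fin N) (Fin N) ℂ}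
    (hH : H.IsHermitian) (hH1 : ‖H‖ ≤ 1) {x : ℝ} (hx : x ∈ spectrum ℝ H) : |x| ≤ 1 := by
  have h := norm_apply_le_norm_cfc (fun t : ℝ => t) H hx continuousOn_id hH
  exact (h.trans (congrArg norm (cfc_id' ℝ H hH)).le).trans hH1

/-- Moments of the soft factors, as a function of the measured matrix. -/
theorem sum_smul_softFactor_mul {N : ℕ} {F : ℝ → ℝ} (hF : IsWindow F) (Δ : ℝ)
    (H : Matrix (Fin N) (Fin N) ℂ) (w : Label Δ → ℝ) :
    ∑ m : Label Δ, (w m : ℂ) • (softFactor F Δ H m * (softFactor F Δ H m)ᴴ)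
      = cfc (fun x : ℝ => ∑ m : Label Δ, w m * F (x / Δ - (m : ℤ))) H := by
  have hcont : ∀ f : ℝ → ℝ, ContinuousOn f (spectrum ℝ H) := fun f =>
    (Matrix.finite_real_spectrum (A := H)).continuousOn f
  have h := cfc_sum_univ (fun (m : Label Δ) (x : ℝ) => w m * F (x / Δ - (m : ℤ))) H
    (fun _ => hcont _)
  have e : (fun x : ℝ => ∑ m : Label Δ, w m * F (x / Δ - (m : ℤ)))
      = ∑ m : Label Δ, fun x : ℝ => w m * F (x / Δ - (m : ℤ)) := by
    ext x; simp
  rw [e, h]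
  refine Finset.sum_congr rfl fun m _ => ?_
  rw [softFactor_conjTranspose, softFactor, ← cfc_mul _ _ _ (hcont _) (hcont _)]
  rw [cfc_const_mul _ _ _ (hcont _), ← algebraMap_smul ℂ (w m)]
  simp only [Real.mul_self_sqrt (hF.nonneg _)]
  rfl

theorem IsWindow.sum_softFactor_mul_eq_one {N : ℕ} {F : ℝ → ℝ} (hF : IsWindow F) {Δ : ℝ}
    (hΔ : 0 < Δ) {H : Matrix (Fin N) (Fin N) ℂ} (hH : H.IsHermitian) (hH1 : ‖H‖ ≤ 1) :
    ∑ m : Label Δ, softFactor F Δ H m * (softFactor F Δ H m)ᴴ = 1 := by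
  have h := sum_smul_softFactor_mul hF Δ H (fun _ => 1)
  simp only [Complex.ofReal_one, one_smul, one_mul] at h
  rw [h, ← cfc_one ℝ H hH]
  exact cfc_congr fun x hx => hF.sum_label_eq_one hΔ (hH.abs_le_of_mem_spectrum hH1 hx)

/-- Bounding the commutators with the single soft factors and adding would cost the number of
labels. The average over the modulated sums `G j` costs nothing, since each of them is bounded and
operator Lipschitz with the same constant. -/
theorem IsWindow.exists_norm_channel_sub_le {F : ℝ → ℝ} (hF : IsWindow F) :
    ∃ C : ℝ, 0 ≤ C ∧ ∀ (N : ℕ) (H X : Matrix (Fin N) (Fin N) ℂ) (Δ : ℝ), 0 < Δ → H.IsHermitian →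
      ‖H‖ ≤ 1 → ‖∑ m : Label Δ, softFactor F Δ H m * X * (softFactor F Δ H m)ᴴ - X‖
        ≤ C * (‖X * H - H * X‖ / Δ) := by
  obtain ⟨C, hC0, hC⟩ := hF.exists_fourier_expansion
  refine ⟨C * C, by positivity, fun N H X Δ hΔ hH hH1 => ?_⟩
  set M : ℤ := ⌈1 / Δ⌉ with hM
  have hM0 : 0 ≤ M := Int.ceil_nonneg (by positivity)
  set L : ℕ := (2 * M + 1).toNat with hLdef
  have hLM : (L : ℤ) = 2 * M + 1 := Int.toNat_of_nonneg (by omega)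
  have hL : 0 < L := by omega
  set B : Label Δ → Matrix (Fin N) (Fin N) ℂ := fun m => softFactor F Δ H m with hB
  set G : ℕ → Matrix (Fin N) (Fin N) ℂ := fun j => ∑ m : Label Δ,
        Complex.exp (((2 * Real.pi * (j / L) * (m : ℤ) : ℝ) : ℂ) * Complex.I) • B m with hG
  have hav : ∀ X, (L : ℂ) • ∑ m, B m * X * (B m)ᴴ = ∑ j ∈ Finset.range L, G j * X * (G j)ᴴ :=
    fun X => sum_mul_mul_conjTranspose_eq_average hL (by omega) B X
  have hkey : ∀ j ∈ Finset.range L, ‖(G j)ᴴ‖ ≤ C ∧ ‖X * (G j)ᴴ - (G j)ᴴ * X‖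
      ≤ C * (‖X * H - H * X‖ / Δ) := by
    intro j hj
    set φ := Unitary.conjStarAlgAut ℂ _ hH.eigenvectorUnitary with hφ
    have hφn : ∀ A, ‖φ A‖ = ‖A‖ := fun A => by
      rw [hφ, Unitary.conjStarAlgAut_apply, ← Unitary.coe_star, CStarRing.norm_mul_coe_unitary,
        CStarRing.norm_coe_unitary_mul]
    have hHφ : H = φ (Matrix.diagonal fun i => (hH.eigenvalues i : ℂ)) := hH.spectral_theorem
    have hBφ : ∀ m, B m = φ (Matrix.diagonal fun i =>
        (√(F (hH.eigenvalues i / Δ - (m : ℤ))) : ℂ)) := fun m => by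
      rw [hB]; simp only [softFactor]; rw [hH.cfc_eq]; rfl
    set g : ℝ → ℂ := fun x => ∑ m : Label Δ,
      Complex.exp (((2 * Real.pi * (j / L) * (m : ℤ) : ℝ) : ℂ) * Complex.I) *
        (√(F (x / Δ - (m : ℤ))) : ℂ) with hg
    have hGφ : G j = φ (Matrix.diagonal fun i => g (hH.eigenvalues i)) := by
      simp only [hG, hBφ, ← map_smul, ← map_sum, hg]
      congr 1
      ext a b
      by_cases hab : a = b
      · subst hab; simp [Matrix.sum_apply]
      · simp [Matrix.sum_apply, Matrix.diagonal_apply_ne _ hab]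
    obtain ⟨c, b, hb, hcb, hs⟩ := hC ((j : ℝ) / L) (by positivity)
      (by
        have : (j : ℝ) ≤ L := by exact_mod_cast (Finset.mem_range.1 hj).le
        rw [div_le_one (by positivity)]; exact this)
    have hgs : ∀ i, HasSum (fun k => c k * Complex.exp (((2 * Real.pi * (k + (j : ℝ) / L)) *
        (hH.eigenvalues i / Δ) : ℝ) * Complex.I)) (g (hH.eigenvalues i)) := by
      intro i
      have hl : |hH.eigenvalues i| ≤ 1 :=
        hH.abs_le_of_mem_spectrum hH1 (hH.eigenvalues_mem_spectrum_real i)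
      have hl2 := abs_div_le_ceil hΔ hl
      convert! hs (hH.eigenvalues i / Δ) using 1
      rw [tsum_eq_sum (s := Finset.Icc (-M) M)]
      · rw [hg]
        exact Finset.sum_coe_sort (Finset.Icc (-M) M) (fun m : ℤ =>
          Complex.exp (((2 * Real.pi * (j / L) * m : ℝ) : ℂ) * Complex.I) *
            (√(F (hH.eigenvalues i / Δ - m)) : ℂ))
      · intro m hm
        rw [hF.eq_zero, Real.sqrt_zero, Complex.ofReal_zero, mul_zero]
        rw [← hM] at hl2
        obtain ⟨h1, h2⟩ := abs_le.1 hl2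
        rw [Finset.mem_Icc, not_and_or, not_le, not_le] at hm
        rcases hm with h | h
        · have : (m : ℝ) + 1 ≤ -M := by exact_mod_cast h
          exact le_abs.2 (Or.inl (by linarith))
        · have : (M : ℝ) + 1 ≤ m := by exact_mod_cast h
          exact le_abs.2 (Or.inr (by linarith))
    -- The expansion concerns `G j`, while the commutator of X with its adjoint is wanted; hence the
    -- bound is applied to Xᴴ, in the eigenbasis of H, and adjoints are taken.
    obtain ⟨Y', hY'⟩ : ∃ Y', φ Y' = Xᴴ := φ.surjective _
    obtain ⟨k1, k2⟩ := norm_diagonal_le_of_hasSum hH.eigenvalues Y' g c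
      (fun k => 2 * Real.pi * (k + (j : ℝ) / L)) b hΔ hb hcb hgs
    have hX2 : X * H - H * X = -(Xᴴ * H - H * Xᴴ)ᴴ := by
      simp only [Matrix.conjTranspose_sub, Matrix.conjTranspose_mul, hH.eq,
        Matrix.conjTranspose_conjTranspose]
      abel
    have hX3 : X * (G j)ᴴ - (G j)ᴴ * X = -(Xᴴ * G j - G j * Xᴴ)ᴴ := by
      simp only [Matrix.conjTranspose_sub, Matrix.conjTranspose_mul,
        Matrix.conjTranspose_conjTranspose]
      abel
    have e1 : Xᴴ * H - H * Xᴴ = φ (Y' * Matrix.diagonal (fun i => (hH.eigenvalues i : ℂ))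
        - Matrix.diagonal (fun i => (hH.eigenvalues i : ℂ)) * Y') := by
      rw [map_sub, map_mul, map_mul, hY', ← hHφ]
    have e2 : Xᴴ * G j - G j * Xᴴ = φ (Y' * Matrix.diagonal (fun i => g (hH.eigenvalues i))
        - Matrix.diagonal (fun i => g (hH.eigenvalues i)) * Y') := by
      rw [map_sub, map_mul, map_mul, hY', ← hGφ]
    rw [hX2, hX3, norm_neg, norm_neg, Matrix.l2_opNorm_conjTranspose,
      Matrix.l2_opNorm_conjTranspose, Matrix.l2_opNorm_conjTranspose, e1, e2, hφn, hφn, hGφ, hφn]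
    exact ⟨k1, k2⟩
  have hone : ∑ m, B m * (B m)ᴴ = 1 := hF.sum_softFactor_mul_eq_one hΔ hH hH1
  -- The average at X = 1 gives ∑ G_j G_jᴴ = L, so LX is subtracted termwise as G_j G_jᴴ X.
  have h1 : (L : ℂ) • (∑ m, B m * X * (B m)ᴴ - X)
      = ∑ j ∈ Finset.range L, G j * (X * (G j)ᴴ - (G j)ᴴ * X) := by
    have h2 := hav 1
    simp only [Matrix.mul_one, hone] at h2
    rw [smul_sub, hav X]
    have h3 : (L : ℂ) • X = (∑ j ∈ Finset.range L, G j * (G j)ᴴ) * X := by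
      rw [← h2, smul_mul_assoc, one_mul]
    rw [h3, Finset.sum_mul, ← Finset.sum_sub_distrib]
    refine Finset.sum_congr rfl fun j _ => ?_
    rw [Matrix.mul_sub, Matrix.mul_assoc, Matrix.mul_assoc]
  have h4 : ‖(L : ℂ) • (∑ m, B m * X * (B m)ᴴ - X)‖
      ≤ L * (C * C * (‖X * H - H * X‖ / Δ)) := by
    rw [h1]
    refine (norm_sum_le_of_le _ (f := fun j => G j * (X * (G j)ᴴ - (G j)ᴴ * X))
      (n := fun _ => C * C * (‖X * H - H * X‖ / Δ)) fun j hj => ?_).trans ?_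
    · obtain ⟨k1, k2⟩ := hkey j hj
      rw [Matrix.l2_opNorm_conjTranspose] at k1
      calc _ ≤ ‖G j‖ * ‖X * (G j)ᴴ - (G j)ᴴ * X‖ := norm_mul_le _ _
        _ ≤ C * (C * (‖X * H - H * X‖ / Δ)) := by gcongr
        _ = _ := by ring
    · simp
  rw [norm_smul, Complex.norm_natCast] at h4
  exact le_of_mul_le_mul_left h4 (by exact_mod_cast hL)

/-! ### Moments of the soft measurement -/

section Kraus

variable {κ ι : Type*} [Fintype κ] [Fintype ι] [DecidableEq ι]

/-- The first factor of the product is the outermost conjugation. The middle term Z may depend on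
all labels, so that weighted sums are covered too. -/
theorem sum_ofFn_prod_succ {d : ℕ} (B : Fin (d + 1) → κ → Matrix ι ι ℂ)
    (Z : (Fin (d + 1) → κ) → Matrix ι ι ℂ) :
    ∑ a : Fin (d + 1) → κ, (List.ofFn fun i => B i (a i)).prod * Z a *
        ((List.ofFn fun i => B i (a i)).prod)ᴴ
      = ∑ m : κ, B 0 m * (∑ a : Fin d → κ, (List.ofFn fun i => B i.succ (a i)).prod *
          Z (Fin.cons m a) * ((List.ofFn fun i => B i.succ (a i)).prod)ᴴ) * (B 0 m)ᴴ := by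
  rw [← (Fin.consEquiv fun _ => κ).sum_comp, Fintype.sum_prod_type]
  refine Finset.sum_congr rfl fun m _ => ?_
  rw [Finset.mul_sum, Finset.sum_mul]
  refine Finset.sum_congr rfl fun a _ => ?_
  simp [Fin.consEquiv, List.ofFn_succ, Matrix.conjTranspose_mul, Matrix.mul_assoc]

theorem sum_ofFn_prod_eq_one {d : ℕ} (B : Fin d → κ → Matrix ι ι ℂ)
    (hB : ∀ i, ∑ m, B i m * (B i m)ᴴ = 1) :
    ∑ a : Fin d → κ, (List.ofFn fun i => B i (a i)).prod *
        ((List.ofFn fun i => B i (a i)).prod)ᴴ = 1 := by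
  induction d with
  | zero => simp
  | succ d ih =>
    have h := sum_ofFn_prod_succ B fun _ => 1
    simp only [Matrix.mul_one] at h
    rw [h, ih _ fun i => hB i.succ]
    simpa using hB 0

/-- Errors add up without growth, because the outer channel contracts the error left by the inner
ones. -/
theorem norm_sum_ofFn_prod_sub_le {d : ℕ} (B : Fin d → κ → Matrix ι ι ℂ) (X : Matrix ι ι ℂ) {r : ℝ}
    (hB : ∀ i, ∑ m, B i m * (B i m)ᴴ = 1) (hr : ∀ i, ‖∑ m, B i m * X * (B i m)ᴴ - X‖ ≤ r) :
    ‖∑ a : Fin d → κ, (List.ofFn fun i => B i (a i)).prod * X *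
        ((List.ofFn fun i => B i (a i)).prod)ᴴ - X‖ ≤ d * r := by
  induction d with
  | zero => simp
  | succ d ih =>
    rw [sum_ofFn_prod_succ B fun _ => X]
    have h := ih _ (fun i => hB i.succ) (fun i => hr i.succ)
    set S := ∑ a : Fin d → κ, (List.ofFn fun i => B i.succ (a i)).prod * X *
      ((List.ofFn fun i => B i.succ (a i)).prod)ᴴ with hS
    have e : ∑ m, B 0 m * S * (B 0 m)ᴴ - X
        = ∑ m, B 0 m * (S - X) * (B 0 m)ᴴ + (∑ m, B 0 m * X * (B 0 m)ᴴ - X) := by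
      simp only [Matrix.mul_sub, Matrix.sub_mul, Finset.sum_sub_distrib]
      abel
    rw [e]
    refine (norm_add_le _ _).trans ?_
    have h2 := Matrix.norm_sum_mul_mul_conjTranspose_le (Z := fun _ => S - X) (norm_nonneg _) (hB 0)
      (fun _ => le_rfl)
    push_cast
    linarith [hr 0]

/-- The factors after the i-th lie inside and sum to 1, the i-th produces its weighted moment, and
the earlier ones act as channels that almost fix X. -/
theorem norm_sum_smul_ofFn_prod_sub_le {d : ℕ} (B : Fin d → κ → Matrix ι ι ℂ) (X : Matrix ι ι ℂ)
    {r : ℝ} (hB : ∀ i, ∑ m, B i m * (B i m)ᴴ = 1)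
    (hr : ∀ i, ‖∑ m, B i m * X * (B i m)ᴴ - X‖ ≤ r) (w : κ → ℂ) (i : Fin d) :
    ‖∑ a : Fin d → κ, w (a i) • ((List.ofFn fun i => B i (a i)).prod *
        ((List.ofFn fun i => B i (a i)).prod)ᴴ) - X‖
      ≤ d * r + ‖∑ m, w m • (B i m * (B i m)ᴴ) - X‖ := by
  have h0 : 0 ≤ r := (norm_nonneg _).trans (hr i)
  induction d with
  | zero => exact i.elim0
  | succ d ih =>
    have h := sum_ofFn_prod_succ B fun a => w (a i) • 1
    simp only [mul_smul_comm, Matrix.mul_one, smul_mul_assoc] at h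
    rw [h]
    cases i using Fin.cases with
    | zero =>
      simp only [Fin.cons_zero, ← Finset.smul_sum, sum_ofFn_prod_eq_one _ fun i => hB (Fin.succ i),
        mul_smul_comm, smul_mul_assoc, Matrix.mul_one]
      have : 0 ≤ ((d + 1 : ℕ) : ℝ) * r := by positivity
      linarith
    | succ i =>
      simp only [Fin.cons_succ]
      have h := ih _ (fun i => hB i.succ) (fun i => hr i.succ) i
      set S := ∑ a : Fin d → κ, w (a i) • ((List.ofFn fun i => B i.succ (a i)).prod *
        ((List.ofFn fun i => B i.succ (a i)).prod)ᴴ) with hS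
      have e : ∑ m, B 0 m * S * (B 0 m)ᴴ - X
          = ∑ m, B 0 m * (S - X) * (B 0 m)ᴴ + (∑ m, B 0 m * X * (B 0 m)ᴴ - X) := by
        simp only [Matrix.mul_sub, Matrix.sub_mul, Finset.sum_sub_distrib]
        abel
      rw [e]
      refine (norm_add_le _ _).trans ?_
      have h2 := Matrix.norm_sum_mul_mul_conjTranspose_le (Z := fun _ => S - X) (norm_nonneg _)
        (hB 0) (fun _ => le_rfl)
      push_cast
      linarith [hr 0]

end Kraus

/-! ### Hermitian and skew parts of almost commuting unitaries -/

section Parts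

set_option linter.unusedSectionVars false

variable {ι : Type*} [Fintype ι] [DecidableEq ι]

theorem rePart_isHermitian (U : Matrix ι ι ℂ) : (rePart U).IsHermitian := by
  rw [Matrix.IsHermitian, rePart, Matrix.conjTranspose_smul, Matrix.conjTranspose_add,
    Matrix.conjTranspose_conjTranspose, add_comm]
  congr 1
  simp

/-- A phase rotation preserves unitarity and norms of commutators, so facts about the Hermitian part
carry over to the skew part. -/
theorem imPart_eq_rePart (U : Matrix ι ι ℂ) : imPart U = rePart ((-Complex.I) • U) := by
  rw [imPart, rePart, Matrix.conjTranspose_smul, smul_sub, smul_add, smul_smul, smul_smul,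
    sub_eq_add_neg, ← neg_smul]
  congr 2
  · field_simp
    rw [Complex.I_sq, neg_neg]
  · rw [star_neg, Complex.star_def, Complex.conj_I]
    field_simp
    rw [Complex.I_sq]

theorem neg_I_smul_mem_unitaryGroup {U : Matrix ι ι ℂ} (hU : U ∈ Matrix.unitaryGroup ι ℂ) :
    (-Complex.I) • U ∈ Matrix.unitaryGroup ι ℂ := by
  rw [Matrix.mem_unitaryGroup_iff] at hU ⊢
  rw [star_smul, smul_mul_smul_comm, hU]
  simp

theorem rePart_norm_le_one {U : Matrix ι ι ℂ} (hU : U ∈ Matrix.unitaryGroup ι ℂ) :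
    ‖rePart U‖ ≤ 1 := by
  have h := Matrix.norm_le_one_of_mem_unitaryGroup hU
  rw [rePart, norm_smul]
  have h2 := norm_add_le U Uᴴ
  rw [Matrix.l2_opNorm_conjTranspose] at h2
  norm_num
  linarith

theorem rePart_add_I_smul_imPart (U : Matrix ι ι ℂ) : rePart U + Complex.I • imPart U = U := by
  rw [rePart, imPart, smul_smul]
  have : Complex.I * (1 / (2 * Complex.I)) = 1 / 2 := by field_simp
  rw [this, ← smul_add, add_add_sub_cancel, ← two_smul ℂ U, smul_smul]
  norm_num

theorem rePart_sq_add_imPart_sq {U : Matrix ι ι ℂ} (hU : U ∈ Matrix.unitaryGroup ι ℂ) :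
    rePart U * rePart U + imPart U * imPart U = 1 := by
  have h1 : U * Uᴴ = 1 := Matrix.mem_unitaryGroup_iff.1 hU
  have h2 : Uᴴ * U = 1 := Matrix.mem_unitaryGroup_iff'.1 hU
  rw [rePart, imPart, smul_mul_smul_comm, smul_mul_smul_comm]
  have : (1 / (2 * Complex.I)) * (1 / (2 * Complex.I)) = -((1 / 2) * (1 / 2)) := by
    field_simp
    rw [Complex.I_sq]; ring
  rw [this, neg_smul, ← smul_neg, ← smul_add]
  simp only [Matrix.add_mul, Matrix.mul_add, Matrix.sub_mul, Matrix.mul_sub, h1, h2]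
  have : U * U + 1 + (1 + Uᴴ * Uᴴ) + -(U * U - 1 - (1 - Uᴴ * Uᴴ)) = (4 : ℂ) • (1 : Matrix ι ι ℂ) := by
    rw [show (4 : ℂ) = 1 + 1 + 1 + 1 by norm_num, add_smul, add_smul, add_smul, one_smul]
    abel
  rw [this, smul_smul]
  norm_num

/-- For unitary V, [U, Vᴴ] = -Vᴴ [U, V] Vᴴ. -/
theorem norm_commutator_conjTranspose_le {U V : Matrix ι ι ℂ} {ε : ℝ}
    (hV : V ∈ Matrix.unitaryGroup ι ℂ) (h : ‖U * V - V * U‖ ≤ ε) : ‖U * Vᴴ - Vᴴ * U‖ ≤ ε := by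
  have h1 : V * Vᴴ = 1 := Matrix.mem_unitaryGroup_iff.1 hV
  have h2 : Vᴴ * V = 1 := Matrix.mem_unitaryGroup_iff'.1 hV
  have h3 : U * Vᴴ - Vᴴ * U = -(Vᴴ * (U * V - V * U) * Vᴴ) := by
    rw [Matrix.mul_sub, Matrix.sub_mul, Matrix.mul_assoc, Matrix.mul_assoc U, h1,
      ← Matrix.mul_assoc Vᴴ V, h2]
    simp
  have h4 := Matrix.norm_le_one_of_mem_unitaryGroup hV
  rw [h3, norm_neg]
  calc _ ≤ ‖Vᴴ‖ * ‖U * V - V * U‖ * ‖Vᴴ‖ :=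
        (norm_mul_le _ _).trans (by gcongr; exact norm_mul_le _ _)
    _ ≤ 1 * ‖U * V - V * U‖ * 1 := by rw [Matrix.l2_opNorm_conjTranspose]; gcongr
    _ ≤ ε := by linarith

theorem norm_commutator_rePart_le {U V : Matrix ι ι ℂ} {ε : ℝ} (hU : U ∈ Matrix.unitaryGroup ι ℂ)
    (hV : V ∈ Matrix.unitaryGroup ι ℂ) (h : ‖U * V - V * U‖ ≤ ε) :
    ‖rePart U * rePart V - rePart V * rePart U‖ ≤ ε := by
  have a1 := norm_commutator_conjTranspose_le hV h
  have a2 : ‖Uᴴ * V - V * Uᴴ‖ ≤ ε := by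
    rw [norm_sub_rev] at h ⊢
    exact norm_commutator_conjTranspose_le hU h
  have a3 := norm_commutator_conjTranspose_le hV a2
  have e : rePart U * rePart V - rePart V * rePart U = (1 / 4 : ℂ) •
      ((U * V - V * U) + (U * Vᴴ - Vᴴ * U) + (Uᴴ * V - V * Uᴴ) + (Uᴴ * Vᴴ - Vᴴ * Uᴴ)) := by
    rw [rePart, rePart, smul_mul_smul_comm, smul_mul_smul_comm, ← smul_sub]
    congr 1
    · norm_num
    · noncomm_ring
  rw [e, norm_smul]
  have := norm_add₄_le (a := U * V - V * U) (b := U * Vᴴ - Vᴴ * U) (c := Uᴴ * V - V * Uᴴ)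
    (d := Uᴴ * Vᴴ - Vᴴ * Uᴴ)
  norm_num
  linarith

theorem norm_commutator_sq_le {X H : Matrix ι ι ℂ} {ε : ℝ} (hX : ‖X‖ ≤ 1)
    (h : ‖X * H - H * X‖ ≤ ε) : ‖X * X * H - H * (X * X)‖ ≤ 2 * ε := by
  have e : X * X * H - H * (X * X) = X * (X * H - H * X) + (X * H - H * X) * X := by noncomm_ring
  rw [e]
  refine (norm_add_le _ _).trans ?_
  have h1 := norm_mul_le X (X * H - H * X)
  have h2 := norm_mul_le (X * H - H * X) X
  nlinarith [norm_nonneg (X * H - H * X), norm_nonneg X]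

end Parts

/-! ### The soft measurement of a soft torus -/

theorem norm_sum_smul_softFactor_sub_le {N : ℕ} {F : ℝ → ℝ} (hF : IsWindow F) {Δ r : ℝ} (hr : 0 ≤ r)
    {H : Matrix (Fin N) (Fin N) ℂ} (hH : H.IsHermitian) (hH1 : ‖H‖ ≤ 1) (w : Label Δ → ℝ) (k : ℕ)
    (h : ∀ x : ℝ, |x| ≤ 1 → |∑ m : Label Δ, w m * F (x / Δ - (m : ℤ)) - x ^ k| ≤ r) :
    ‖∑ m : Label Δ, (w m : ℂ) • (softFactor F Δ H m * (softFactor F Δ H m)ᴴ) - H ^ k‖ ≤ r := by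
  have hcont : ∀ f : ℝ → ℝ, ContinuousOn f (spectrum ℝ H) := fun f =>
    (Matrix.finite_real_spectrum (A := H)).continuousOn f
  rw [sum_smul_softFactor_mul hF Δ H w]
  have e : H ^ k = cfc (fun x : ℝ => x ^ k) H := (cfc_pow_id H k hH).symm
  rw [e, ← cfc_sub _ _ _ (hcont _) (hcont _)]
  exact norm_cfc_le hr fun x hx => h x (hH.abs_le_of_mem_spectrum hH1 hx)

section SoftPOVM

variable {d N : ℕ} {F : ℝ → ℝ} {U : Fin d → Matrix (Fin N) (Fin N) ℂ}

theorem softPOVM_apply (F : ℝ → ℝ) (Δ : ℝ) (U : Fin d → Matrix (Fin N) (Fin N) ℂ) (a : Outcome d Δ) :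
    softPOVM F Δ U a =
      (List.ofFn fun i => softFactor F Δ (rePart (U i)) (a.1 i)).prod *
        ((List.ofFn fun i => softFactor F Δ (imPart (U i)) (a.2 i)).prod *
          ((List.ofFn fun i => softFactor F Δ (imPart (U i)) (a.2 i)).prod)ᴴ) *
        ((List.ofFn fun i => softFactor F Δ (rePart (U i)) (a.1 i)).prod)ᴴ := by
  simp only [softPOVM, softKraus, Matrix.conjTranspose_mul, Matrix.mul_assoc]

theorem imPart_isHermitian (V : Matrix (Fin N) (Fin N) ℂ) : (imPart V).IsHermitian := by
  rw [imPart_eq_rePart]; exact rePart_isHermitian _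

theorem imPart_norm_le_one {V : Matrix (Fin N) (Fin N) ℂ} (hV : V ∈ Matrix.unitaryGroup (Fin N) ℂ) :
    ‖imPart V‖ ≤ 1 := by
  rw [imPart_eq_rePart]; exact rePart_norm_le_one (neg_I_smul_mem_unitaryGroup hV)

theorem IsWindow.softPOVM_isPOVM (hF : IsWindow F) {Δ : ℝ} (hΔ : 0 < Δ)
    (hU : ∀ i, U i ∈ Matrix.unitaryGroup (Fin N) ℂ) : IsPOVM (softPOVM F Δ U) where
  posSemidef a := Matrix.posSemidef_self_mul_conjTranspose _
  sum_eq_one := by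
    rw [Fintype.sum_prod_type]
    simp only [softPOVM_apply, ← Finset.sum_mul, ← Finset.mul_sum]
    rw [sum_ofFn_prod_eq_one (fun i (m : Label Δ) => softFactor F Δ (imPart (U i)) m) fun i =>
      hF.sum_softFactor_mul_eq_one hΔ (imPart_isHermitian _) (imPart_norm_le_one (hU i))]
    simp only [Matrix.mul_one]
    exact sum_ofFn_prod_eq_one (fun i (m : Label Δ) => softFactor F Δ (rePart (U i)) m) fun i =>
      hF.sum_softFactor_mul_eq_one hΔ (rePart_isHermitian _) (rePart_norm_le_one (hU i))

/-- For a Y-label the inner Y-channels and then all d outer X-channels contribute, whence 2dr. For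
an X-label the Y-factors sum to 1 and dr would do. -/
theorem IsWindow.norm_sum_smul_softPOVM_sub_le (hF : IsWindow F) {Δ : ℝ} (hΔ : 0 < Δ)
    (hU : ∀ i, U i ∈ Matrix.unitaryGroup (Fin N) ℂ) (X : Matrix (Fin N) (Fin N) ℂ) {r s : ℝ}
    (hre : ∀ j, ‖∑ m : Label Δ, softFactor F Δ (rePart (U j)) m * X *
      (softFactor F Δ (rePart (U j)) m)ᴴ - X‖ ≤ r)
    (him : ∀ j, ‖∑ m : Label Δ, softFactor F Δ (imPart (U j)) m * X *
      (softFactor F Δ (imPart (U j)) m)ᴴ - X‖ ≤ r)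
    (w : Label Δ → ℂ) (i : Fin d) :
    (‖∑ m : Label Δ, w m • (softFactor F Δ (rePart (U i)) m * (softFactor F Δ (rePart (U i)) m)ᴴ)
        - X‖ ≤ s → ‖∑ a : Outcome d Δ, w (a.1 i) • softPOVM F Δ U a - X‖ ≤ 2 * (d * r) + s) ∧
    (‖∑ m : Label Δ, w m • (softFactor F Δ (imPart (U i)) m * (softFactor F Δ (imPart (U i)) m)ᴴ)
        - X‖ ≤ s → ‖∑ a : Outcome d Δ, w (a.2 i) • softPOVM F Δ U a - X‖ ≤ 2 * (d * r) + s) := by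
  have hB1 : ∀ i, ∑ m : Label Δ, softFactor F Δ (rePart (U i)) m *
      (softFactor F Δ (rePart (U i)) m)ᴴ = 1 := fun i =>
    hF.sum_softFactor_mul_eq_one hΔ (rePart_isHermitian _) (rePart_norm_le_one (hU i))
  have hB2 : ∀ i, ∑ m : Label Δ, softFactor F Δ (imPart (U i)) m *
      (softFactor F Δ (imPart (U i)) m)ᴴ = 1 := fun i =>
    hF.sum_softFactor_mul_eq_one hΔ (imPart_isHermitian _) (imPart_norm_le_one (hU i))
  have hr : 0 ≤ (d : ℝ) * r := mul_nonneg (Nat.cast_nonneg d) ((norm_nonneg _).trans (hre i))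
  constructor
  · intro hs
    rw [Fintype.sum_prod_type]
    simp only [softPOVM_apply, ← Finset.smul_sum, ← Finset.sum_mul, ← Finset.mul_sum]
    rw [sum_ofFn_prod_eq_one (fun i (m : Label Δ) => softFactor F Δ (imPart (U i)) m) hB2]
    simp only [Matrix.mul_one]
    have := norm_sum_smul_ofFn_prod_sub_le (fun i (m : Label Δ) => softFactor F Δ (rePart (U i)) m) X
      hB1 hre w i
    linarith
  · intro hs
    rw [Fintype.sum_prod_type]
    have e : ∀ (c : ℂ) (P R : Matrix (Fin N) (Fin N) ℂ), c • (P * R * Pᴴ) = P * (c • R) * Pᴴ := by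
      simp
    simp only [softPOVM_apply, e, ← Finset.sum_mul, ← Finset.mul_sum]
    have h2 := norm_sum_smul_ofFn_prod_sub_le (fun i (m : Label Δ) => softFactor F Δ (imPart (U i)) m) X
      hB2 him w i
    set S := ∑ a : Fin d → Label Δ, w (a i) •
      ((List.ofFn fun i => softFactor F Δ (imPart (U i)) (a i)).prod *
        ((List.ofFn fun i => softFactor F Δ (imPart (U i)) (a i)).prod)ᴴ) with hS
    have h1 := norm_sum_ofFn_prod_sub_le (fun i (m : Label Δ) => softFactor F Δ (rePart (U i)) m) X
      hB1 hre
    have h3 := Matrix.norm_sum_mul_mul_conjTranspose_le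
      (B := fun a : Fin d → Label Δ => (List.ofFn fun i => softFactor F Δ (rePart (U i)) (a i)).prod)
      (Z := fun _ => S - X) (norm_nonneg _)
      (sum_ofFn_prod_eq_one (fun i (m : Label Δ) => softFactor F Δ (rePart (U i)) m) hB1)
      (fun _ => le_rfl)
    simp only [Matrix.mul_sub, Matrix.sub_mul, Finset.sum_sub_distrib] at h3
    have h4 := norm_add_le_of_le h3 h1
    rw [sub_add_sub_cancel] at h4
    linarith

/-- The first two moments of the soft measurement of a soft torus. -/
theorem IsWindow.exists_softPOVM_moments_le (hF : IsWindow F) :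
    ∃ C : ℝ, 1 ≤ C ∧ ∀ (d N : ℕ) (ε : ℝ) (U : Fin d → Matrix (Fin N) (Fin N) ℂ),
      IsSoftTorus ε U → ∀ Δ : ℝ, 0 < Δ → ∀ i,
        ‖∑ a : Outcome d Δ, (((a.1 i : ℤ) * Δ : ℝ) : ℂ) • softPOVM F Δ U a - rePart (U i)‖
          ≤ C * (Δ + d * ε / Δ) ∧
        ‖∑ a : Outcome d Δ, (((a.2 i : ℤ) * Δ : ℝ) : ℂ) • softPOVM F Δ U a - imPart (U i)‖
          ≤ C * (Δ + d * ε / Δ) ∧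
        ‖∑ a : Outcome d Δ, ((((a.1 i : ℤ) * Δ) ^ 2 : ℝ) : ℂ) • softPOVM F Δ U a
          - rePart (U i) ^ 2‖ ≤ C * (Δ + d * ε / Δ) ∧
        ‖∑ a : Outcome d Δ, ((((a.2 i : ℤ) * Δ) ^ 2 : ℝ) : ℂ) • softPOVM F Δ U a
          - imPart (U i) ^ 2‖ ≤ C * (Δ + d * ε / Δ) := by
  obtain ⟨C₁, hC₁, h₁⟩ := hF.exists_norm_channel_sub_le
  obtain ⟨C₂, hC₂, h₂⟩ := hF.exists_abs_sum_label_sq_sub_le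
  -- With r = C₁ · 2ε/Δ, where the 2 allows for commutators with squares, 2dr = 4C₁ dε/Δ; and (C₂ +
  -- 1)Δ covers both scalar errors, Δ and C₂Δ.
  refine ⟨4 * C₁ + C₂ + 1, by linarith, fun d N ε U hU Δ hΔ i => ?_⟩
  obtain ⟨hU, hc⟩ := hU
  have hε : 0 ≤ ε := (norm_nonneg _).trans (hc i i)
  have hch : ∀ (X H : Matrix (Fin N) (Fin N) ℂ) (η : ℝ), H.IsHermitian → ‖H‖ ≤ 1 →
      ‖X * H - H * X‖ ≤ η → η ≤ 2 * ε → ‖∑ m : Label Δ, softFactor F Δ H m * X *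
        (softFactor F Δ H m)ᴴ - X‖ ≤ C₁ * (2 * ε / Δ) := fun X H η hH hH1 hη hη2 =>
    (h₁ N H X Δ hΔ hH hH1).trans (by gcongr; exact hη.trans hη2)
  have hcomm : ∀ {V W : Matrix (Fin N) (Fin N) ℂ} (z w : ℂ), ‖z‖ = 1 → ‖w‖ = 1 →
      ‖V * W - W * V‖ ≤ ε → ‖(z • V) * (w • W) - (w • W) * (z • V)‖ ≤ ε := by
    intro V W z w hz hw h
    rw [smul_mul_smul_comm, smul_mul_smul_comm, mul_comm w z, ← smul_sub, norm_smul, norm_mul, hz, hw]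
    simpa using h
  -- both quadratures at once, through the phase of the unitary
  have key : ∀ (z : ℂ), ‖z‖ = 1 → (∀ {V : Matrix (Fin N) (Fin N) ℂ},
      V ∈ Matrix.unitaryGroup (Fin N) ℂ → z • V ∈ Matrix.unitaryGroup (Fin N) ℂ) → ∀ k : ℕ, k = 1 ∨ k = 2 →
      (∀ j, ‖∑ m : Label Δ, softFactor F Δ (rePart (U j)) m * rePart (z • U i) ^ k *
        (softFactor F Δ (rePart (U j)) m)ᴴ - rePart (z • U i) ^ k‖ ≤ C₁ * (2 * ε / Δ)) ∧
      (∀ j, ‖∑ m : Label Δ, softFactor F Δ (imPart (U j)) m * rePart (z • U i) ^ k *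
        (softFactor F Δ (imPart (U j)) m)ᴴ - rePart (z • U i) ^ k‖ ≤ C₁ * (2 * ε / Δ)) := by
    intro z hz hzV k hk
    have hpow : ∀ {H : Matrix (Fin N) (Fin N) ℂ}, ‖rePart (z • U i) * H - H * rePart (z • U i)‖ ≤ ε →
        ‖rePart (z • U i) ^ k * H - H * rePart (z • U i) ^ k‖ ≤ 2 * ε := by
      intro H h
      rcases hk with rfl | rfl
      · rw [pow_one]; linarith
      · rw [pow_two]; exact norm_commutator_sq_le (rePart_norm_le_one (hzV (hU i))) h
    refine ⟨fun j => hch _ _ _ (rePart_isHermitian _) (rePart_norm_le_one (hU j)) (hpow ?_) le_rfl,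
      fun j => hch _ _ _ (imPart_isHermitian _) (imPart_norm_le_one (hU j)) (hpow ?_) le_rfl⟩
    · have := hcomm z 1 hz norm_one (hc i j)
      rw [one_smul] at this
      exact norm_commutator_rePart_le (hzV (hU i)) (hU j) this
    · rw [imPart_eq_rePart]
      exact norm_commutator_rePart_le (hzV (hU i)) (neg_I_smul_mem_unitaryGroup (hU j))
        (hcomm z _ hz (by simp) (hc i j))
  have hA := key 1 norm_one (by simp)
  have hB := key (-Complex.I) (by simp) neg_I_smul_mem_unitaryGroup
  simp only [one_smul] at hA
  simp only [← imPart_eq_rePart] at hB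
  have hfin : ∀ s : ℝ, s ≤ (C₂ + 1) * Δ →
      2 * (d * (C₁ * (2 * ε / Δ))) + s ≤ (4 * C₁ + C₂ + 1) * (Δ + d * ε / Δ) := by
    intro s hs
    have e : 2 * (d * (C₁ * (2 * ε / Δ))) = 4 * C₁ * (d * ε / Δ) := by ring
    have p : 0 ≤ d * ε / Δ := by positivity
    have q : 0 ≤ C₁ * Δ := by positivity
    rw [e]; nlinarith
  have hm1 : ∀ x : ℝ, |x| ≤ 1 →
      |∑ m : Label Δ, ((m : ℤ) * Δ) * F (x / Δ - (m : ℤ)) - x ^ 1| ≤ Δ := fun x hx => by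
    rw [pow_one]; exact hF.abs_sum_label_sub_le hΔ hx
  have hm2 := fun x (hx : |x| ≤ 1) => h₂ Δ x hΔ hx
  have f1 : Δ ≤ (C₂ + 1) * Δ := by nlinarith
  have f2 : C₂ * Δ ≤ (C₂ + 1) * Δ := by nlinarith
  have g0 : 0 ≤ C₂ * Δ := by positivity
  refine ⟨?_, ?_, ?_, ?_⟩
  · have h := hA 1 (Or.inl rfl)
    have h' := norm_sum_smul_softFactor_sub_le hF hΔ.le (rePart_isHermitian (U i))
      (rePart_norm_le_one (hU i)) (fun m : Label Δ => (m : ℤ) * Δ) 1 hm1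
    have := (hF.norm_sum_smul_softPOVM_sub_le hΔ hU _ h.1 h.2 _ i).1 h'
    rw [pow_one] at this
    exact this.trans (hfin _ f1)
  · have h := hB 1 (Or.inl rfl)
    have h' := norm_sum_smul_softFactor_sub_le hF hΔ.le (imPart_isHermitian (U i))
      (imPart_norm_le_one (hU i)) (fun m : Label Δ => (m : ℤ) * Δ) 1 hm1
    have := (hF.norm_sum_smul_softPOVM_sub_le hΔ hU _ h.1 h.2 _ i).2 h'
    rw [pow_one] at this
    exact this.trans (hfin _ f1)
  · have h := hA 2 (Or.inr rfl)
    have h' := norm_sum_smul_softFactor_sub_le hF g0 (rePart_isHermitian (U i))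
      (rePart_norm_le_one (hU i)) (fun m : Label Δ => ((m : ℤ) * Δ) ^ 2) 2 hm2
    exact ((hF.norm_sum_smul_softPOVM_sub_le hΔ hU _ h.1 h.2 _ i).1 h').trans (hfin _ f2)
  · have h := hB 2 (Or.inr rfl)
    have h' := norm_sum_smul_softFactor_sub_le hF g0 (imPart_isHermitian (U i))
      (imPart_norm_le_one (hU i)) (fun m : Label Δ => ((m : ℤ) * Δ) ^ 2) 2 hm2
    exact ((hF.norm_sum_smul_softPOVM_sub_le hΔ hU _ h.1 h.2 _ i).2 h').trans (hfin _ f2)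

end SoftPOVM

/-! ### The dilated tuple -/

section Dilation

variable {κ : Type*} [Fintype κ]

theorem IsNaimarkDilation.isPVM {N K : ℕ} {E : κ → Matrix (Fin N) (Fin N) ℂ}
    {Q : κ → Matrix (Fin N ⊕ Fin K) (Fin N ⊕ Fin K) ℂ} (h : IsNaimarkDilation E Q) : IsPVM Q :=
  ⟨h.isProj, h.orthogonal, h.sum_eq_one⟩

theorem pvmSum_toBlocks₁₁ {N K : ℕ} {E : κ → Matrix (Fin N) (Fin N) ℂ}
    {Q : κ → Matrix (Fin N ⊕ Fin K) (Fin N ⊕ Fin K) ℂ} (h : IsNaimarkDilation E Q) (c : κ → ℂ) :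
    (pvmSum Q c).toBlocks₁₁ = ∑ a, c a • E a := by
  simp_rw [← h.compress]
  ext i j
  simp [pvmSum, Matrix.toBlocks₁₁, Matrix.sum_apply]

/-- Every positive operator-valued measure given by Kraus operators has a Naimark dilation. -/
theorem exists_isNaimarkDilation [Nonempty κ] {N : ℕ} (A : κ → Matrix (Fin N) (Fin N) ℂ)
    (hA : ∑ a, A a * (A a)ᴴ = 1) :
    ∃ (K : ℕ) (Q : κ → Matrix (Fin N ⊕ Fin K) (Fin N ⊕ Fin K) ℂ),
      IsNaimarkDilation (fun a => A a * (A a)ᴴ) Q := by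
  classical
  obtain ⟨a₀⟩ := ‹Nonempty κ›
  set K := Fintype.card (κ × Fin N) with hK
  set e : Fin K ≃ κ × Fin N := (Fintype.equivFin _).symm with he
  -- The Stinespring isometry: the column of the blocks (A_a)ᴴ.
  set W : Matrix (Fin K) (Fin N) ℂ := Matrix.of fun k j => (A (e k).1)ᴴ (e k).2 j with hW
  set P : κ → Matrix (Fin K) (Fin K) ℂ := fun a =>
    Matrix.diagonal fun k => if (e k).1 = a then 1 else 0 with hP
  have hWP : ∀ a, Wᴴ * (P a * W) = A a * (A a)ᴴ := by
    intro a
    ext i j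
    rw [Matrix.mul_apply, Matrix.mul_apply, ← e.symm.sum_comp, Fintype.sum_prod_type]
    rw [Finset.sum_eq_single a]
    · refine Finset.sum_congr rfl fun l _ => ?_
      simp [hP, hW, Matrix.diagonal_mul]
    · intro b _ hb
      refine Finset.sum_eq_zero fun l _ => ?_
      simp [hP, Matrix.diagonal_mul, hb]
    · simp
  have hPsum : ∑ a, P a = 1 := by
    ext i j
    rcases eq_or_ne i j with rfl | hij
    · simp [hP, Matrix.sum_apply]
    · simp [hP, Matrix.sum_apply, hij]
  have hWW : Wᴴ * W = 1 := by
    rw [← hA]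
    simp_rw [← hWP]
    rw [← Matrix.mul_sum, ← Matrix.sum_mul, hPsum, Matrix.one_mul]
  -- A self-adjoint unitary that exchanges the first summand with the range of W. Conjugating the
  -- label projectors by it gives the dilation.
  set S : Matrix (Fin N ⊕ Fin K) (Fin N ⊕ Fin K) ℂ := Matrix.fromBlocks 0 Wᴴ W (1 - W * Wᴴ) with hS
  have hSS : S * S = 1 := by
    have h1 : Wᴴ * (1 - W * Wᴴ) = 0 := by
      rw [Matrix.mul_sub, ← Matrix.mul_assoc, hWW]; simp
    have h2 : (1 - W * Wᴴ) * W = 0 := by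
      rw [Matrix.sub_mul, Matrix.mul_assoc, hWW]; simp
    have h3 : W * Wᴴ + (1 - W * Wᴴ) * (1 - W * Wᴴ) = 1 := by
      rw [Matrix.mul_sub, ← Matrix.mul_assoc (1 - W * Wᴴ), h2]; simp
    rw [hS, Matrix.fromBlocks_multiply, hWW, h1, h2, h3]
    simp
  have hSH : Sᴴ = S := by
    rw [hS, Matrix.fromBlocks_conjTranspose]
    simp
  -- The first summand also needs a label for the projectors to sum to 1. Any label serves, because
  -- the upper left block of S is 0.
  set f : Fin N ⊕ Fin K → κ := Sum.elim (fun _ => a₀) (fun k => (e k).1) with hf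
  set D : κ → Matrix (Fin N ⊕ Fin K) (Fin N ⊕ Fin K) ℂ := fun a =>
    Matrix.diagonal fun t => if f t = a then 1 else 0 with hD
  have hDD : ∀ a b, (S * D a * S) * (S * D b * S) = S * (D a * D b) * S := by
    intro a b
    calc (S * D a * S) * (S * D b * S) = S * D a * (S * S) * D b * S := by noncomm_ring
      _ = _ := by rw [hSS]; noncomm_ring
  refine ⟨K, fun a => S * D a * S, fun a => ⟨?_, ?_⟩, fun a b hab => ?_, ?_, fun a => ?_⟩
  · change (S * D a * S) * (S * D a * S) = S * D a * S
    rw [hDD]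
    congr 2
    simp [hD]
  · change (S * D a * S)ᴴ = S * D a * S
    rw [Matrix.conjTranspose_mul, Matrix.conjTranspose_mul, hSH, ← Matrix.mul_assoc]
    congr 2
    rw [hD, Matrix.diagonal_conjTranspose]
    congr 1
    ext t
    simp only [Pi.star_apply]
    split_ifs <;> simp
  · rw [hDD]
    have : D a * D b = 0 := by
      rw [hD, Matrix.diagonal_mul_diagonal, ← Matrix.diagonal_zero]
      congr 1
      ext t
      by_cases h : f t = a
      · simp [h, hab]
      · simp [h]
    rw [this]; simp
  · rw [← Finset.sum_mul, ← Finset.mul_sum]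
    have : ∑ a, D a = 1 := by
      ext i j
      rcases eq_or_ne i j with rfl | hij
      · simp [hD, Matrix.sum_apply]
      · simp [hD, Matrix.sum_apply, hij]
    rw [this, Matrix.mul_one, hSS]
  · have : D a = Matrix.fromBlocks (Matrix.diagonal fun _ => if a₀ = a then 1 else 0) 0 0 (P a) := by
      rw [hP, Matrix.fromBlocks_diagonal]
      simp only [hD]
      congr 1
      ext t
      rcases t with t | t <;> simp [hf]
    rw [this, hS, Matrix.fromBlocks_multiply, Matrix.fromBlocks_multiply, Matrix.toBlocks_fromBlocks₁₁,
      ← hWP]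
    simp [Matrix.mul_assoc]

/-- The limit of the phases of `v + x z`, as `x` decreases to `0`. -/
def limitPhase (z v : ℂ) : ℂ := if v = 0 then z else v * ((‖v‖⁻¹ : ℝ) : ℂ)

theorem norm_limitPhase {z : ℂ} (hz : ‖z‖ = 1) (v : ℂ) : ‖limitPhase z v‖ = 1 := by
  rw [limitPhase]
  split_ifs with h
  · exact hz
  · rw [norm_mul, Complex.norm_real, norm_inv, norm_norm, mul_inv_cancel₀ (norm_ne_zero_iff.2 h)]

theorem limitPhase_mul_norm (z v : ℂ) : limitPhase z v * ‖v‖ = v := by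
  rw [limitPhase]
  split_ifs with h
  · simp [h]
  · rw [mul_assoc, ← Complex.ofReal_mul, inv_mul_cancel₀ (norm_ne_zero_iff.2 h)]
    simp

theorem tendsto_limitPhase {z : ℂ} (hz : ‖z‖ = 1) (v : ℂ) :
    Tendsto (fun x : ℝ => (v + (x : ℂ) * z) * ((‖v + (x : ℂ) * z‖⁻¹ : ℝ) : ℂ)) (𝓝[>] 0)
      (𝓝 (limitPhase z v)) := by
  rw [limitPhase]
  split_ifs with h
  · refine tendsto_const_nhds.congr' ?_
    filter_upwards [self_mem_nhdsWithin] with x hx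
    have hx : (0 : ℝ) < x := hx
    have hx' : (x : ℂ) ≠ 0 := by exact_mod_cast hx.ne'
    rw [h, zero_add, norm_mul, hz, mul_one, Complex.norm_real, Real.norm_eq_abs, abs_of_pos hx]
    push_cast
    field_simp
  · have h1 : Tendsto (fun x : ℝ => v + (x : ℂ) * z) (𝓝[>] 0) (𝓝 v) := by
      have : Continuous fun x : ℝ => v + (x : ℂ) * z := by fun_prop
      have := (this.tendsto 0).mono_left (nhdsWithin_le_nhds (s := Set.Ioi 0))
      simpa using this
    exact h1.mul ((Complex.continuous_ofReal.tendsto _).comp (h1.norm.inv₀ (norm_ne_zero_iff.2 h)))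

theorem IsPVM.tendsto_polar {ι : Type*} [Fintype ι] [DecidableEq ι] {Q : κ → Matrix ι ι ℂ}
    (hQ : IsPVM Q) {z : ℂ} (hz : ‖z‖ = 1) (v : κ → ℂ) :
    Tendsto (fun x : ℝ => polar (pvmSum Q v + ((x : ℂ) * z) • 1)) (𝓝[>] 0)
      (𝓝 (pvmSum Q fun a => limitPhase z (v a))) := by
  have h : ∀ x : ℝ, polar (pvmSum Q v + ((x : ℂ) * z) • 1)
      = pvmSum Q fun a => (v a + (x : ℂ) * z) * ((‖v a + (x : ℂ) * z‖⁻¹ : ℝ) : ℂ) := by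
    intro x
    rw [← hQ.pvmSum_const, ← pvmSum_add, hQ.polar_pvmSum]
    rfl
  simp_rw [h]
  exact tendsto_finsetSum _ fun a _ => (tendsto_limitPhase hz (v a)).smul_const (Q a)

theorem IsPVM.isUnit_pvmSum {ι : Type*} [Fintype ι] [DecidableEq ι] {Q : κ → Matrix ι ι ℂ}
    (hQ : IsPVM Q) {c : κ → ℂ} (hc : ∀ a, c a ≠ 0) : IsUnit (pvmSum Q c) := by
  refine IsUnit.of_mul_eq_one (pvmSum Q c⁻¹) ?_
  rw [← hQ.pvmSum_mul, ← hQ.pvmSum_one]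
  congr 1
  ext a
  simp [hc a]

/-- If v + xz = 0 with |z| = 1 and x > 0, then z = -v/|v|. So finitely many points of the infinite
unit circle are excluded. -/
theorem exists_unit_add_ne_zero {s : Set ℂ} (hs : s.Finite) :
    ∃ z : ℂ, ‖z‖ = 1 ∧ ∀ v ∈ s, ∀ x : ℝ, 0 < x → v + (x : ℂ) * z ≠ 0 := by
  have hinf : (Metric.sphere (0 : ℂ) 1).Infinite := by
    intro hfin
    have h1 : (Set.Icc (0 : ℝ) 1).Infinite := Set.Icc_infinite one_pos
    refine h1 (Set.Finite.of_injOn (f := fun t : ℝ => Complex.exp (t * Complex.I)) (fun t _ => ?_) ?_ hfin)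
    · simp [Complex.norm_exp_ofReal_mul_I]
    · intro t ht u hu h
      obtain ⟨n, hn⟩ := Complex.exp_eq_exp_iff_exists_int.1 h
      have h2 : (t : ℂ) = u + n * (2 * Real.pi) := by
        have := mul_right_cancel₀ Complex.I_ne_zero
          (show (t : ℂ) * Complex.I = (u + n * (2 * Real.pi)) * Complex.I by rw [hn]; ring)
        exact this
      have h3 : t = u + n * (2 * Real.pi) := by exact_mod_cast h2
      have hn0 : n = 0 := by
        have h4 : |(n : ℝ) * (2 * Real.pi)| ≤ 1 := by
          rw [show (n : ℝ) * (2 * Real.pi) = t - u by linarith, abs_le]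
          constructor <;> linarith [ht.1, ht.2, hu.1, hu.2]
        rw [abs_mul, abs_of_pos Real.two_pi_pos] at h4
        have h5 : |(n : ℝ)| < 1 := by nlinarith [Real.pi_gt_three, abs_nonneg (n : ℝ)]
        have h6 : |n| < 1 := by exact_mod_cast h5
        exact Int.abs_lt_one_iff.1 h6
      rw [h3, hn0]; simp
  obtain ⟨z, hz, hzs⟩ := hinf.exists_notMem_finite (hs.image fun v => -(v * ((‖v‖⁻¹ : ℝ) : ℂ)))
  have hz1 : ‖z‖ = 1 := by simpa using hz
  refine ⟨z, hz1, fun v hv x hx h => hzs ⟨v, hv, ?_⟩⟩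
  have hv' : v = -(x * z) := eq_neg_of_add_eq_zero_left h
  have hx' : (x : ℂ) ≠ 0 := by exact_mod_cast hx.ne'
  have : ‖v‖ = x := by
    rw [hv', norm_neg, norm_mul, hz1, Complex.norm_real, Real.norm_eq_abs, abs_of_pos hx, mul_one]
  simp only [this]
  rw [hv']
  push_cast
  field_simp

end Dilation

/-! ### Joint diagonal form of the dilated unitaries -/

section MapF

variable {d N K : ℕ} {Δ : ℝ} {Q : Outcome d Δ → Matrix (Fin N ⊕ Fin K) (Fin N ⊕ Fin K) ℂ}

/-- The eigenvalues of `V_i`. -/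
def outcomeValue (Δ : ℝ) (i : Fin d) (a : Outcome d Δ) : ℂ :=
  (((a.1 i : ℤ) * Δ : ℝ) : ℂ) + Complex.I * (((a.2 i : ℤ) * Δ : ℝ) : ℂ)

theorem dilX_eq_pvmSum (i : Fin d) :
    dilX Q i = pvmSum Q fun a => (((a.1 i : ℤ) * Δ : ℝ) : ℂ) := rfl

theorem dilY_eq_pvmSum (i : Fin d) :
    dilY Q i = pvmSum Q fun a => (((a.2 i : ℤ) * Δ : ℝ) : ℂ) := rfl

theorem dilV_eq_pvmSum (i : Fin d) : dilV Q i = pvmSum Q (outcomeValue Δ i) := by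
  rw [dilV, dilX_eq_pvmSum, dilY_eq_pvmSum, ← pvmSum_smul, ← pvmSum_add]
  rfl

/-- Uniqueness of limits yields an explicit formula for every admissible choice of dilation and z.
Unitarity, commutation and the estimates are read off from it. -/
theorem IsMapF.eq_pvmSum {F : ℝ → ℝ} {U : Fin d → Matrix (Fin N) (Fin N) ℂ} {z : ℂ}
    {U' : Fin d → Matrix (Fin N ⊕ Fin K) (Fin N ⊕ Fin K) ℂ} (h : IsMapF F Δ U Q z U') (i : Fin d) :
    U' i = pvmSum Q fun a => limitPhase z (outcomeValue Δ i a) := by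
  have h1 := h.tendsto_polar i
  rw [dilV_eq_pvmSum] at h1
  exact tendsto_nhds_unique h1 (h.dilation.isPVM.tendsto_polar h.norm_z _)

theorem IsWindow.exists_isMapF {F : ℝ → ℝ} (hF : IsWindow F) (hΔ : 0 < Δ)
    {U : Fin d → Matrix (Fin N) (Fin N) ℂ} (hU : ∀ i, U i ∈ Matrix.unitaryGroup (Fin N) ℂ) :
    ∃ (K : ℕ) (Q : Outcome d Δ → Matrix (Fin N ⊕ Fin K) (Fin N ⊕ Fin K) ℂ) (z : ℂ)
      (U' : Fin d → Matrix (Fin N ⊕ Fin K) (Fin N ⊕ Fin K) ℂ), IsMapF F Δ U Q z U' := by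
  have h0 : 0 ≤ ⌈1 / Δ⌉ := Int.ceil_nonneg (by positivity)
  have : Nonempty (Label Δ) := ⟨⟨0, Finset.mem_Icc.2 ⟨by omega, h0⟩⟩⟩
  obtain ⟨K, Q, hQ⟩ := exists_isNaimarkDilation (softKraus F Δ U)
    (hF.softPOVM_isPOVM hΔ hU).sum_eq_one
  obtain ⟨z, hz, hzv⟩ := exists_unit_add_ne_zero
    (Set.finite_range fun p : Fin d × Outcome d Δ => outcomeValue Δ p.1 p.2)
  refine ⟨K, Q, z, fun i => pvmSum Q fun a => limitPhase z (outcomeValue Δ i a), hQ, hz,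
    fun i x hx _ => ?_, fun i => ?_⟩
  · rw [dilV_eq_pvmSum, ← hQ.isPVM.pvmSum_const, ← pvmSum_add]
    exact hQ.isPVM.isUnit_pvmSum fun a => hzv _ ⟨(i, a), rfl⟩ x hx
  · rw [dilV_eq_pvmSum]
    exact hQ.isPVM.tendsto_polar hz _

end MapF

/-! ### Compression to the first summand -/

section Compression

/-- The inclusion of `ℂ^N` into `ℂ^N ⊕ ℂ^K`. -/
def blockIncl (N K : ℕ) : Matrix (Fin N ⊕ Fin K) (Fin N) ℂ := Matrix.fromRows 1 0

variable {N K : ℕ}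

theorem blockIncl_conjTranspose_mul_self : (blockIncl N K)ᴴ * blockIncl N K = 1 := by
  simp [blockIncl, Matrix.conjTranspose_fromRows_eq_fromCols_conjTranspose, Matrix.fromCols_mul_fromRows]

theorem blockIncl_mul_conjTranspose : blockIncl N K * (blockIncl N K)ᴴ = blockProj N K := by
  simp only [blockIncl, blockProj, Matrix.conjTranspose_fromRows_eq_fromCols_conjTranspose]
  ext (i | i) (j | j) <;> simp

theorem toBlocks₁₁_eq_blockIncl (M : Matrix (Fin N ⊕ Fin K) (Fin N ⊕ Fin K) ℂ) :
    M.toBlocks₁₁ = (blockIncl N K)ᴴ * M * blockIncl N K := by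
  conv_rhs => rw [← Matrix.fromBlocks_toBlocks M]
  simp [blockIncl, Matrix.conjTranspose_fromRows_eq_fromCols_conjTranspose,
    Matrix.fromCols_mul_fromBlocks, Matrix.fromCols_mul_fromRows]

theorem norm_blockIncl_le : ‖blockIncl N K‖ ≤ 1 := by
  have h := Matrix.l2_opNorm_conjTranspose_mul_self (blockIncl N K)
  rw [blockIncl_conjTranspose_mul_self] at h
  nlinarith [Matrix.norm_one_le (ι := Fin N), norm_nonneg (blockIncl N K)]

theorem norm_blockIncl_conjTranspose_le : ‖(blockIncl N K)ᴴ‖ ≤ 1 := by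
  rw [Matrix.l2_opNorm_conjTranspose]; exact norm_blockIncl_le

theorem blockProj_isStarProjection : IsStarProjection (blockProj N K) := by
  constructor
  · simp [IsIdempotentElem, blockProj, Matrix.fromBlocks_multiply]
  · simp [IsSelfAdjoint, blockProj, Matrix.star_eq_conjTranspose, Matrix.fromBlocks_conjTranspose]

theorem norm_mul_blockIncl_le (M : Matrix (Fin N ⊕ Fin K) (Fin N ⊕ Fin K) ℂ) :
    ‖M * blockIncl N K‖ ≤ ‖M‖ :=
  (Matrix.l2_opNorm_mul _ _).trans (mul_le_of_le_one_right (norm_nonneg _) norm_blockIncl_le)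

theorem norm_blockIncl_mul_le {l : Type*} [Fintype l] [DecidableEq l] (A : Matrix (Fin N) l ℂ) :
    ‖blockIncl N K * A‖ ≤ ‖A‖ :=
  (Matrix.l2_opNorm_mul _ _).trans (mul_le_of_le_one_left (norm_nonneg _) norm_blockIncl_le)

theorem norm_blockIncl_conjTranspose_mul_le {l : Type*} [Fintype l] [DecidableEq l]
    (A : Matrix (Fin N ⊕ Fin K) l ℂ) : ‖(blockIncl N K)ᴴ * A‖ ≤ ‖A‖ :=
  (Matrix.l2_opNorm_mul _ _).trans
    (mul_le_of_le_one_left (norm_nonneg _) norm_blockIncl_conjTranspose_le)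

theorem norm_mul_blockIncl_conjTranspose_le {l : Type*} [Fintype l] [DecidableEq l]
    (A : Matrix l (Fin N) ℂ) : ‖A * (blockIncl N K)ᴴ‖ ≤ ‖A‖ :=
  (Matrix.l2_opNorm_mul _ _).trans
    (mul_le_of_le_one_right (norm_nonneg _) norm_blockIncl_conjTranspose_le)

theorem norm_blockProj_mul_mul_le (M : Matrix (Fin N ⊕ Fin K) (Fin N ⊕ Fin K) ℂ) :
    ‖blockProj N K * M * blockProj N K‖ ≤ ‖M * blockIncl N K‖ := by
  have : blockProj N K * M * blockProj N K
      = blockIncl N K * ((blockIncl N K)ᴴ * (M * blockIncl N K) * (blockIncl N K)ᴴ) := by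
    simp only [← blockIncl_mul_conjTranspose, Matrix.mul_assoc]
  rw [this]
  exact (norm_blockIncl_mul_le _).trans ((norm_mul_blockIncl_conjTranspose_le _).trans
    (norm_blockIncl_conjTranspose_mul_le _))

/-- Small variance makes the compressed matrix intertwine with the large one. -/
theorem norm_mul_blockIncl_sub_sq_le {A : Matrix (Fin N ⊕ Fin K) (Fin N ⊕ Fin K) ℂ}
    {X : Matrix (Fin N) (Fin N) ℂ} (hA : Aᴴ = A) (hX : Xᴴ = X) (hX1 : ‖X‖ ≤ 1) {r : ℝ}
    (h1 : ‖A.toBlocks₁₁ - X‖ ≤ r) (h2 : ‖(A * A).toBlocks₁₁ - X ^ 2‖ ≤ r) :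
    ‖A * blockIncl N K - blockIncl N K * X‖ ^ 2 ≤ 3 * r := by
  set J := blockIncl N K with hJ
  have hJJ : Jᴴ * J = 1 := blockIncl_conjTranspose_mul_self
  rw [toBlocks₁₁_eq_blockIncl, ← hJ] at h1 h2
  -- Each of the three terms has norm at most r, whence 3r.
  have e : (A * J - J * X)ᴴ * (A * J - J * X)
      = (Jᴴ * (A * A) * J - X ^ 2) - (Jᴴ * A * J - X) * X - X * (Jᴴ * A * J - X) := by
    rw [Matrix.conjTranspose_sub, Matrix.conjTranspose_mul, Matrix.conjTranspose_mul, hA, hX]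
    have : X * Jᴴ * (J * X) = X * X := by
      rw [Matrix.mul_assoc, ← Matrix.mul_assoc Jᴴ, hJJ, Matrix.one_mul]
    simp only [Matrix.sub_mul, Matrix.mul_sub, this, pow_two]
    simp only [Matrix.mul_assoc]
    abel
  rw [pow_two, ← Matrix.l2_opNorm_conjTranspose_mul_self, e]
  have g1 := norm_mul_le (Jᴴ * A * J - X) X
  have g2 := norm_mul_le X (Jᴴ * A * J - X)
  have g3 := norm_sub_le (Jᴴ * (A * A) * J - X ^ 2 - (Jᴴ * A * J - X) * X) (X * (Jᴴ * A * J - X))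
  have g4 := norm_sub_le (Jᴴ * (A * A) * J - X ^ 2) ((Jᴴ * A * J - X) * X)
  nlinarith [norm_nonneg (Jᴴ * A * J - X), norm_nonneg X]

/-- Since J = J(X² + Y²), the left side is the sum of JX² - A²J and JY² - B²J. Passing J through one
factor at a time costs (2 + 1)r for each. -/
theorem norm_one_sub_mul_blockIncl_le {A B : Matrix (Fin N ⊕ Fin K) (Fin N ⊕ Fin K) ℂ}
    {X Y : Matrix (Fin N) (Fin N) ℂ} (hXY : X * X + Y * Y = 1) (hX : ‖X‖ ≤ 1) (hY : ‖Y‖ ≤ 1)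
    (hA : ‖A‖ ≤ 2) (hB : ‖B‖ ≤ 2) {r : ℝ} (h1 : ‖A * blockIncl N K - blockIncl N K * X‖ ≤ r)
    (h2 : ‖B * blockIncl N K - blockIncl N K * Y‖ ≤ r) :
    ‖(1 - A * A - B * B) * blockIncl N K‖ ≤ 6 * r := by
  set J := blockIncl N K with hJ
  have e : (1 - A * A - B * B) * J = -(A * (A * J - J * X) + (A * J - J * X) * X)
      - (B * (B * J - J * Y) + (B * J - J * Y) * Y) := by
    have : J * (X * X + Y * Y) = J := by rw [hXY, Matrix.mul_one]
    have e2 : J = J * (X * X) + J * (Y * Y) := by rw [← Matrix.mul_add, this]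
    simp only [Matrix.sub_mul, Matrix.mul_sub, Matrix.one_mul, Matrix.mul_assoc]
    nth_rewrite 1 [e2]
    abel
  have k : ∀ (A : Matrix (Fin N ⊕ Fin K) (Fin N ⊕ Fin K) ℂ) (X : Matrix (Fin N) (Fin N) ℂ),
      ‖A‖ ≤ 2 → ‖X‖ ≤ 1 → ‖A * J - J * X‖ ≤ r →
      ‖A * (A * J - J * X) + (A * J - J * X) * X‖ ≤ 3 * r := by
    intro A X hA hX h
    have g1 := Matrix.l2_opNorm_mul A (A * J - J * X)
    have g2 := Matrix.l2_opNorm_mul (A * J - J * X) X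
    have g3 := norm_add_le (A * (A * J - J * X)) ((A * J - J * X) * X)
    nlinarith [norm_nonneg (A * J - J * X), norm_nonneg A, norm_nonneg X]
  rw [e]
  refine (norm_sub_le _ _).trans ?_
  rw [norm_neg]
  linarith [k A X hA hX h1, k B Y hB hY h2]

theorem norm_conjTranspose_commutator_le {P U : Matrix (Fin N ⊕ Fin K) (Fin N ⊕ Fin K) ℂ}
    (hP : Pᴴ = P) : ‖P * Uᴴ - Uᴴ * P‖ = ‖P * U - U * P‖ := by
  rw [← Matrix.l2_opNorm_conjTranspose, Matrix.conjTranspose_sub, Matrix.conjTranspose_mul,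
    Matrix.conjTranspose_mul, Matrix.conjTranspose_conjTranspose, hP, norm_sub_rev]

/-- Compressions are multiplicative up to a product of commutators with the projector. -/
theorem toBlocks₁₁_mul_toBlocks₁₁ (U V : Matrix (Fin N ⊕ Fin K) (Fin N ⊕ Fin K) ℂ) :
    U.toBlocks₁₁ * V.toBlocks₁₁ = (U * V).toBlocks₁₁
      + ((blockProj N K * U - U * blockProj N K) * (blockProj N K * V - V * blockProj N K)).toBlocks₁₁ := by
  simp only [toBlocks₁₁_eq_blockIncl, ← blockIncl_mul_conjTranspose]
  set J := blockIncl N K with hJ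
  have hJJ : Jᴴ * J = 1 := blockIncl_conjTranspose_mul_self
  have h1 : Jᴴ * (J * Jᴴ * U - U * (J * Jᴴ)) = Jᴴ * U - Jᴴ * U * J * Jᴴ := by
    rw [Matrix.mul_sub, Matrix.mul_assoc J, ← Matrix.mul_assoc Jᴴ J, hJJ, Matrix.one_mul]
    simp only [Matrix.mul_assoc]
  have h2 : (J * Jᴴ * V - V * (J * Jᴴ)) * J = J * (Jᴴ * V * J) - V * J := by
    rw [Matrix.sub_mul, Matrix.mul_assoc V, Matrix.mul_assoc J Jᴴ J, hJJ, Matrix.mul_one]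
    simp only [Matrix.mul_assoc]
  have h4 : ∀ A B : Matrix (Fin N ⊕ Fin K) (Fin N ⊕ Fin K) ℂ,
      Jᴴ * (A * B) * J = (Jᴴ * A) * (B * J) := fun A B => by simp only [Matrix.mul_assoc]
  rw [h4 (J * Jᴴ * U - U * (J * Jᴴ)), h1, h2]
  have h3 : (Jᴴ * U - Jᴴ * U * J * Jᴴ) * (J * (Jᴴ * V * J)) = 0 := by
    rw [← Matrix.mul_assoc, Matrix.sub_mul, Matrix.mul_assoc (Jᴴ * U * J), hJJ]
    simp
  rw [Matrix.mul_sub, h3, Matrix.sub_mul]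
  simp only [Matrix.mul_assoc]
  abel

theorem norm_toBlocks₁₁_le (M : Matrix (Fin N ⊕ Fin K) (Fin N ⊕ Fin K) ℂ) :
    ‖M.toBlocks₁₁‖ ≤ ‖M‖ := by
  rw [toBlocks₁₁_eq_blockIncl, Matrix.mul_assoc]
  exact (norm_blockIncl_conjTranspose_mul_le _).trans (norm_mul_blockIncl_le _)

/-- The upper left block of a unitary that almost commutes with the block projector. -/
theorem norm_one_sub_toBlocks₁₁_le {U : Matrix (Fin N ⊕ Fin K) (Fin N ⊕ Fin K) ℂ}
    (hU : U ∈ Matrix.unitaryGroup (Fin N ⊕ Fin K) ℂ) :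
    ‖1 - (U.toBlocks₁₁)ᴴ * U.toBlocks₁₁‖ ≤ ‖blockProj N K * U - U * blockProj N K‖ ^ 2 := by
  have h1 : (U.toBlocks₁₁)ᴴ = (Uᴴ).toBlocks₁₁ := by
    simp [toBlocks₁₁_eq_blockIncl, Matrix.conjTranspose_mul, Matrix.mul_assoc]
  have h2 : Uᴴ * U = 1 := Matrix.mem_unitaryGroup_iff'.1 hU
  have h3 : (1 : Matrix (Fin N ⊕ Fin K) (Fin N ⊕ Fin K) ℂ).toBlocks₁₁ = 1 := by
    rw [toBlocks₁₁_eq_blockIncl, Matrix.mul_one, blockIncl_conjTranspose_mul_self]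
  rw [h1, toBlocks₁₁_mul_toBlocks₁₁, h2, h3, sub_add_cancel_left, norm_neg, pow_two]
  refine (norm_toBlocks₁₁_le _).trans ((norm_mul_le _ _).trans ?_)
  rw [norm_conjTranspose_commutator_le blockProj_isStarProjection.isSelfAdjoint.star_eq]

theorem norm_commutator_toBlocks₁₁_le {U V : Matrix (Fin N ⊕ Fin K) (Fin N ⊕ Fin K) ℂ} {r : ℝ}
    (hUV : U * V = V * U) (hU : ‖blockProj N K * U - U * blockProj N K‖ ≤ r)
    (hV : ‖blockProj N K * V - V * blockProj N K‖ ≤ r) :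
    ‖U.toBlocks₁₁ * V.toBlocks₁₁ - V.toBlocks₁₁ * U.toBlocks₁₁‖ ≤ 2 * r ^ 2 := by
  have hr : 0 ≤ r := (norm_nonneg _).trans hU
  rw [toBlocks₁₁_mul_toBlocks₁₁, toBlocks₁₁_mul_toBlocks₁₁, hUV, add_sub_add_left_eq_sub]
  refine (norm_sub_le _ _).trans ?_
  have k : ∀ A B : Matrix (Fin N ⊕ Fin K) (Fin N ⊕ Fin K) ℂ, ‖A‖ ≤ r → ‖B‖ ≤ r →
      ‖(A * B).toBlocks₁₁‖ ≤ r ^ 2 := fun A B hA hB => by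
    refine (norm_toBlocks₁₁_le _).trans ((norm_mul_le _ _).trans ?_)
    rw [pow_two]; gcongr
  linarith [k _ _ hU hV, k _ _ hV hU]

/-- With the projector written as JJᴴ, both JJᴴU' and U'JJᴴ are within r of JUJᴴ; the first uses the
adjoint intertwining. -/
theorem norm_commutator_blockProj_le {U' : Matrix (Fin N ⊕ Fin K) (Fin N ⊕ Fin K) ℂ}
    {U : Matrix (Fin N) (Fin N) ℂ} {r : ℝ} (h1 : ‖U' * blockIncl N K - blockIncl N K * U‖ ≤ r)
    (h2 : ‖U'ᴴ * blockIncl N K - blockIncl N K * Uᴴ‖ ≤ r) :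
    ‖blockProj N K * U' - U' * blockProj N K‖ ≤ 2 * r := by
  set J := blockIncl N K with hJ
  have e : blockProj N K * U' - U' * blockProj N K
      = J * (U'ᴴ * J - J * Uᴴ)ᴴ - (U' * J - J * U) * Jᴴ := by
    rw [← blockIncl_mul_conjTranspose, ← hJ]
    simp only [Matrix.conjTranspose_sub, Matrix.conjTranspose_mul, Matrix.conjTranspose_conjTranspose,
      Matrix.mul_sub, Matrix.sub_mul, Matrix.mul_assoc]
    abel
  rw [e]
  refine (norm_sub_le _ _).trans ?_
  have g1 := norm_blockIncl_mul_le (K := K) (U'ᴴ * J - J * Uᴴ)ᴴ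
  have g2 := norm_mul_blockIncl_conjTranspose_le (K := K) (U' * J - J * U)
  rw [Matrix.l2_opNorm_conjTranspose] at g1
  linarith

theorem isUnit_of_norm_one_sub_conjTranspose_mul_lt {T : Matrix (Fin N) (Fin N) ℂ}
    (h : ‖1 - Tᴴ * T‖ < 1) : IsUnit T := by
  have h1 : IsUnit (Tᴴ * T) := by
    have := isUnit_one_sub_of_norm_lt_one h
    rwa [sub_sub_cancel] at this
  rw [Matrix.isUnit_iff_isUnit_det, Matrix.det_mul] at h1
  rw [Matrix.isUnit_iff_isUnit_det]
  exact isUnit_of_mul_isUnit_right h1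

/-- Replacing A by S, replacing B by T, and [S, T] itself cost 2r each. -/
theorem norm_commutator_le_of_close {A B S T : Matrix (Fin N) (Fin N) ℂ} {r : ℝ}
    (hB : ‖B‖ ≤ 1) (hS : ‖S‖ ≤ 1) (hAS : ‖A - S‖ ≤ r) (hBT : ‖B - T‖ ≤ r)
    (h : ‖S * T - T * S‖ ≤ 2 * r) : ‖A * B - B * A‖ ≤ 6 * r := by
  have e : A * B - B * A = ((A - S) * B - B * (A - S)) + (S * (B - T) - (B - T) * S)
      + (S * T - T * S) := by noncomm_ring
  have k : ∀ C D : Matrix (Fin N) (Fin N) ℂ, ‖C‖ ≤ r → ‖D‖ ≤ 1 → ‖C * D‖ ≤ r ∧ ‖D * C‖ ≤ r := by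
    intro C D hC hD
    have g1 := norm_mul_le C D
    have g2 := norm_mul_le D C
    constructor <;> nlinarith [norm_nonneg C, norm_nonneg D]
  obtain ⟨k1, k2⟩ := k _ _ hAS hB
  obtain ⟨k3, k4⟩ := k _ _ hBT hS
  rw [e]
  refine (norm_add₃_le).trans ?_
  have g1 := norm_sub_le ((A - S) * B) (B * (A - S))
  have g2 := norm_sub_le (S * (B - T)) ((B - T) * S)
  linarith

end Compression

/-! ### Estimates for the dilated unitaries -/

theorem Label.abs_mul_le_two {Δ : ℝ} (hΔ : 0 < Δ) (hΔ1 : Δ ≤ 1) (m : Label Δ) :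
    |((m : ℤ) : ℝ) * Δ| ≤ 2 := by
  obtain ⟨h1, h2⟩ := Finset.mem_Icc.1 m.2
  have h3 : |((m : ℤ) : ℝ)| ≤ (⌈1 / Δ⌉ : ℤ) := by
    rw [abs_le]; exact ⟨by exact_mod_cast h1, by exact_mod_cast h2⟩
  have h4 := Int.ceil_lt_add_one (1 / Δ)
  have h5 : 1 / Δ * Δ = 1 := by field_simp
  rw [abs_mul, abs_of_pos hΔ]
  nlinarith

/-- This makes U' - V a contraction times 1 - X'² - Y'². It stays valid at v = 0, so no lower bound
on |v| is ever needed. -/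
theorem limitPhase_sub {z : ℂ} (v : ℂ) :
    limitPhase z v - v = limitPhase z v * (((1 + ‖v‖)⁻¹ : ℝ) : ℂ) * ((1 - ‖v‖ ^ 2 : ℝ) : ℂ) := by
  have h : (1 + (‖v‖ : ℂ)) ≠ 0 := by
    have : (0 : ℝ) < 1 + ‖v‖ := by positivity
    exact_mod_cast this.ne'
  have h2 := limitPhase_mul_norm z v
  nth_rewrite 2 [← h2]
  push_cast
  field_simp
  ring

theorem norm_limitPhase_mul_inv_le {z : ℂ} (hz : ‖z‖ = 1) (v : ℂ) :
    ‖limitPhase z v * (((1 + ‖v‖)⁻¹ : ℝ) : ℂ)‖ ≤ 1 := by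
  rw [norm_mul, norm_limitPhase hz, one_mul, Complex.norm_real, norm_inv, Real.norm_eq_abs,
    abs_of_pos (by positivity)]
  exact inv_le_one_of_one_le₀ (by linarith [norm_nonneg v])

section Estimates

variable {d N K : ℕ} {Δ : ℝ} {Q : Outcome d Δ → Matrix (Fin N ⊕ Fin K) (Fin N ⊕ Fin K) ℂ}

theorem norm_outcomeValue_sq (i : Fin d) (a : Outcome d Δ) :
    ‖outcomeValue Δ i a‖ ^ 2 = ((a.1 i : ℤ) * Δ) ^ 2 + ((a.2 i : ℤ) * Δ) ^ 2 := by
  rw [outcomeValue, mul_comm Complex.I, ← Complex.normSq_eq_norm_sq, Complex.normSq_add_mul_I]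

theorem IsPVM.one_sub_dilX_sq_sub_dilY_sq (hQ : IsPVM Q) (i : Fin d) :
    1 - dilX Q i * dilX Q i - dilY Q i * dilY Q i
      = pvmSum Q fun a => ((1 - ‖outcomeValue Δ i a‖ ^ 2 : ℝ) : ℂ) := by
  rw [dilX_eq_pvmSum, dilY_eq_pvmSum, ← hQ.pvmSum_mul, ← hQ.pvmSum_mul, ← hQ.pvmSum_one,
    ← pvmSum_sub, ← pvmSum_sub]
  congr 1
  ext a
  rw [norm_outcomeValue_sq]
  simp only [Pi.sub_apply, Pi.one_apply, Pi.mul_apply]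
  push_cast
  ring

theorem IsPVM.pvmSum_real_conjTranspose (hQ : IsPVM Q) (c : Outcome d Δ → ℝ) :
    (pvmSum Q fun a => (c a : ℂ))ᴴ = pvmSum Q fun a => (c a : ℂ) := by
  rw [hQ.pvmSum_conjTranspose]
  congr 1
  ext a
  simp

theorem IsPVM.pvmSum_real_mul_self (hQ : IsPVM Q) (c : Outcome d Δ → ℝ) :
    (pvmSum Q fun a => (c a : ℂ)) * (pvmSum Q fun a => (c a : ℂ))
      = pvmSum Q fun a => ((c a ^ 2 : ℝ) : ℂ) := by
  rw [← hQ.pvmSum_mul]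
  congr 1
  ext a
  simp [pow_two]

theorem IsMapF.norm_intertwine_le {F : ℝ → ℝ} {U : Fin d → Matrix (Fin N) (Fin N) ℂ} {z : ℂ}
    {U' : Fin d → Matrix (Fin N ⊕ Fin K) (Fin N ⊕ Fin K) ℂ} (h : IsMapF F Δ U Q z U')
    (hΔ : 0 < Δ) (hU : ∀ i, U i ∈ Matrix.unitaryGroup (Fin N) ℂ) {i : Fin d} {b : ℝ} (hb : Δ ≤ b)
    (hx : ‖(dilX Q i).toBlocks₁₁ - rePart (U i)‖ ≤ b)
    (hy : ‖(dilY Q i).toBlocks₁₁ - imPart (U i)‖ ≤ b)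
    (hx2 : ‖(dilX Q i * dilX Q i).toBlocks₁₁ - rePart (U i) ^ 2‖ ≤ b)
    (hy2 : ‖(dilY Q i * dilY Q i).toBlocks₁₁ - imPart (U i) ^ 2‖ ≤ b) :
    ‖(U' i - dilV Q i) * blockIncl N K‖ ≤ 6 * √(3 * b) ∧
    ‖U' i * blockIncl N K - blockIncl N K * U i‖ ≤ 8 * √(3 * b) ∧
    ‖(U' i)ᴴ * blockIncl N K - blockIncl N K * (U i)ᴴ‖ ≤ 8 * √(3 * b) := by
  have hQ := h.dilation.isPVM
  set J := blockIncl N K with hJ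
  set X := rePart (U i) with hX
  set Y := imPart (U i) with hY
  have hXs : Xᴴ = X := rePart_isHermitian _
  have hYs : Yᴴ = Y := imPart_isHermitian _
  have hX1 : ‖X‖ ≤ 1 := rePart_norm_le_one (hU i)
  have hY1 : ‖Y‖ ≤ 1 := imPart_norm_le_one (hU i)
  have hdX : (dilX Q i)ᴴ = dilX Q i := by
    rw [dilX_eq_pvmSum]; exact hQ.pvmSum_real_conjTranspose _
  have hdY : (dilY Q i)ᴴ = dilY Q i := by
    rw [dilY_eq_pvmSum]; exact hQ.pvmSum_real_conjTranspose _
  set r := √(3 * b) with hr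
  have hr0 : 0 ≤ r := Real.sqrt_nonneg _
  have kX : ‖dilX Q i * J - J * X‖ ≤ r := Real.le_sqrt_of_sq_le
    (norm_mul_blockIncl_sub_sq_le hdX hXs hX1 hx hx2)
  have kY : ‖dilY Q i * J - J * Y‖ ≤ r := Real.le_sqrt_of_sq_le
    (norm_mul_blockIncl_sub_sq_le hdY hYs hY1 hy hy2)
  have hUXY : X + Complex.I • Y = U i := rePart_add_I_smul_imPart (U i)
  have eV : dilV Q i * J - J * U i
      = (dilX Q i * J - J * X) + Complex.I • (dilY Q i * J - J * Y) := by
    rw [← hUXY, dilV, Matrix.add_mul, Matrix.mul_add, Matrix.smul_mul, Matrix.mul_smul, smul_sub]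
    abel
  have eV' : (dilV Q i)ᴴ * J - J * (U i)ᴴ
      = (dilX Q i * J - J * X) - Complex.I • (dilY Q i * J - J * Y) := by
    rw [← hUXY, dilV, Matrix.conjTranspose_add, Matrix.conjTranspose_smul, hdX, hdY,
      Matrix.conjTranspose_add, Matrix.conjTranspose_smul, hXs, hYs, Complex.star_def, Complex.conj_I,
      Matrix.add_mul, Matrix.mul_add, Matrix.smul_mul, Matrix.mul_smul, smul_sub, neg_smul, neg_smul]
    abel
  have kI : ‖Complex.I • (dilY Q i * J - J * Y)‖ ≤ r := by
    rw [norm_smul, Complex.norm_I, one_mul]; exact kY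
  have kV : ‖dilV Q i * J - J * U i‖ ≤ 2 * r := by
    rw [eV]; exact (norm_add_le _ _).trans (by linarith)
  have kV' : ‖(dilV Q i)ᴴ * J - J * (U i)ᴴ‖ ≤ 2 * r := by
    rw [eV']; exact (norm_sub_le _ _).trans (by linarith)
  have hU' : U' i ∈ Matrix.unitaryGroup _ ℂ := by
    rw [h.eq_pvmSum]; exact hQ.pvmSum_mem_unitaryGroup fun a => norm_limitPhase h.norm_z _
  have split1 : U' i * J - J * U i = (U' i - dilV Q i) * J + (dilV Q i * J - J * U i) := by
    rw [Matrix.sub_mul]; abel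
  have split2 : (U' i)ᴴ * J - J * (U i)ᴴ
      = (U' i - dilV Q i)ᴴ * J + ((dilV Q i)ᴴ * J - J * (U i)ᴴ) := by
    rw [Matrix.conjTranspose_sub, Matrix.sub_mul]; abel
  rcases le_total Δ 1 with h1 | h1
  · have hT : ‖(1 - dilX Q i * dilX Q i - dilY Q i * dilY Q i) * J‖ ≤ 6 * r := by
      refine norm_one_sub_mul_blockIncl_le (rePart_sq_add_imPart_sq (hU i)) hX1 hY1 ?_ ?_ kX kY
      · rw [dilX_eq_pvmSum]
        refine hQ.norm_pvmSum_le zero_le_two fun a => ?_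
        rw [Complex.norm_real]; exact Label.abs_mul_le_two hΔ h1 _
      · rw [dilY_eq_pvmSum]
        refine hQ.norm_pvmSum_le zero_le_two fun a => ?_
        rw [Complex.norm_real]; exact Label.abs_mul_le_two hΔ h1 _
    set g : Outcome d Δ → ℂ := fun a =>
      limitPhase z (outcomeValue Δ i a) * (((1 + ‖outcomeValue Δ i a‖)⁻¹ : ℝ) : ℂ) with hg
    have hgn : ∀ a, ‖g a‖ ≤ 1 := fun a => norm_limitPhase_mul_inv_le h.norm_z _
    have hG : U' i - dilV Q i
        = pvmSum Q g * (1 - dilX Q i * dilX Q i - dilY Q i * dilY Q i) := by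
      rw [hQ.one_sub_dilX_sq_sub_dilY_sq, ← hQ.pvmSum_mul, h.eq_pvmSum, dilV_eq_pvmSum, ← pvmSum_sub]
      congr 1
      ext a
      exact limitPhase_sub _
    have hG' : (U' i - dilV Q i)ᴴ
        = pvmSum Q (star g) * (1 - dilX Q i * dilX Q i - dilY Q i * dilY Q i) := by
      rw [hG, hQ.one_sub_dilX_sq_sub_dilY_sq, Matrix.conjTranspose_mul, hQ.pvmSum_real_conjTranspose,
        hQ.pvmSum_conjTranspose, ← hQ.pvmSum_mul, ← hQ.pvmSum_mul, mul_comm]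
    have a1 : ‖(U' i - dilV Q i) * J‖ ≤ 6 * r := by
      rw [hG, Matrix.mul_assoc]
      refine (Matrix.l2_opNorm_mul _ _).trans ?_
      have := hQ.norm_pvmSum_le zero_le_one hgn
      nlinarith [norm_nonneg (pvmSum Q g),
        norm_nonneg ((1 - dilX Q i * dilX Q i - dilY Q i * dilY Q i) * J)]
    have a2 : ‖(U' i - dilV Q i)ᴴ * J‖ ≤ 6 * r := by
      rw [hG', Matrix.mul_assoc]
      refine (Matrix.l2_opNorm_mul _ _).trans ?_
      have := hQ.norm_pvmSum_le (c := star g) zero_le_one fun a => by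
        rw [Pi.star_apply, norm_star]; exact hgn a
      nlinarith [norm_nonneg (pvmSum Q (star g)),
        norm_nonneg ((1 - dilX Q i * dilX Q i - dilY Q i * dilY Q i) * J)]
    refine ⟨a1, ?_, ?_⟩
    · rw [split1]; exact (norm_add_le _ _).trans (by linarith)
    · rw [split2]; exact (norm_add_le _ _).trans (by linarith)
  -- For Δ ≥ 1 the eigenvalues of X' and Y' need not be at most 2 in modulus, but b ≥ Δ gives r ≥ 1,
  -- and trivial bounds on unitaries suffice.
  · have hr1 : 1 ≤ r := Real.le_sqrt_of_sq_le (by linarith)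
    have n1 := Matrix.norm_le_one_of_mem_unitaryGroup hU'
    have n2 := Matrix.norm_le_one_of_mem_unitaryGroup (hU i)
    have m1 := norm_mul_blockIncl_le (U' i)
    have m2 := norm_mul_blockIncl_le (U' i)ᴴ
    have m3 := norm_blockIncl_mul_le (K := K) (U i)
    have m4 := norm_blockIncl_mul_le (K := K) (U i)ᴴ
    rw [Matrix.l2_opNorm_conjTranspose] at m2 m4
    have b1 : ‖U' i * J - J * U i‖ ≤ 2 := (norm_sub_le _ _).trans (by linarith)
    have b2 : ‖(U' i)ᴴ * J - J * (U i)ᴴ‖ ≤ 2 := (norm_sub_le _ _).trans (by linarith)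
    refine ⟨?_, by linarith, by linarith⟩
    rw [eq_sub_of_add_eq split1.symm]
    exact (norm_sub_le _ _).trans (by linarith)

/-- The compositions of the soft measurement with the polar decomposition of the compression. -/
theorem mapG_estimates {U : Fin d → Matrix (Fin N) (Fin N) ℂ}
    {U' : Fin d → Matrix (Fin N ⊕ Fin K) (Fin N ⊕ Fin K) ℂ} {δ r : ℝ} (hδ : δ < 1)
    (hloc : IsLocalProjector δ (blockProj N K) U')
    (h1 : ∀ i, ‖U' i * blockIncl N K - blockIncl N K * U i‖ ≤ 8 * r)
    (h2 : ∀ i, ‖blockProj N K * U' i - U' i * blockProj N K‖ ≤ 16 * r) :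
    (∀ i, IsUnit (U' i).toBlocks₁₁) ∧ (∀ i, ‖mapG U' i - U i‖ ≤ 24 * r) ∧
      IsSoftTorus (6 * (16 * r) ^ 2) (mapG U') := by
  have hk := fun i => norm_one_sub_toBlocks₁₁_le (hloc.unitary i)
  have hu : ∀ i, IsUnit (U' i).toBlocks₁₁ := fun i => by
    refine isUnit_of_norm_one_sub_conjTranspose_mul_lt ((hk i).trans_lt ?_)
    have := hloc.norm_comm_le i
    nlinarith [norm_nonneg (blockProj N K * U' i - U' i * blockProj N K)]
  have hp := fun i => polar_mem_unitaryGroup_and_norm_sub_le (hu i)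
  have hn : ∀ i, ‖(U' i).toBlocks₁₁‖ ≤ 1 := fun i =>
    (norm_toBlocks₁₁_le _).trans (Matrix.norm_le_one_of_mem_unitaryGroup (hloc.unitary i))
  have hsq : ∀ i, ‖mapG U' i - (U' i).toBlocks₁₁‖ ≤ (16 * r) ^ 2 := fun i =>
    ((hp i).2.trans (hk i)).trans (pow_le_pow_left₀ (norm_nonneg _) (h2 i) 2)
  refine ⟨hu, fun i => ?_, fun i => (hp i).1, fun i j => ?_⟩
  -- The polar error is at most t², with t the norm of the commutator with the projector; t ≤ δ < 1
  -- gives t² ≤ t.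
  · have a1 : ‖mapG U' i - (U' i).toBlocks₁₁‖ ≤ 16 * r := by
      refine ((hp i).2.trans (hk i)).trans ?_
      have := hloc.norm_comm_le i
      nlinarith [norm_nonneg (blockProj N K * U' i - U' i * blockProj N K), h2 i]
    have a2 : ‖(U' i).toBlocks₁₁ - U i‖ ≤ 8 * r := by
      have e : (U' i).toBlocks₁₁ - U i
          = (blockIncl N K)ᴴ * (U' i * blockIncl N K - blockIncl N K * U i) := by
        rw [toBlocks₁₁_eq_blockIncl, Matrix.mul_sub, ← Matrix.mul_assoc _ (blockIncl N K) (U i),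
          blockIncl_conjTranspose_mul_self, Matrix.one_mul, Matrix.mul_assoc]
      rw [e]
      exact (norm_blockIncl_conjTranspose_mul_le _).trans (h1 i)
    have := norm_add_le_of_le a1 a2
    rw [sub_add_sub_cancel] at this
    linarith
  · exact norm_commutator_le_of_close (Matrix.norm_le_one_of_mem_unitaryGroup (hp j).1) (hn i)
      (hsq i) (hsq j) (norm_commutator_toBlocks₁₁_le (hloc.commute i j) (h2 i) (h2 j))

end Estimates

theorem IsMapF.isLocalProjector {d N K : ℕ} {F : ℝ → ℝ} {Δ r : ℝ}
    {U : Fin d → Matrix (Fin N) (Fin N) ℂ}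
    {Q : Outcome d Δ → Matrix (Fin N ⊕ Fin K) (Fin N ⊕ Fin K) ℂ} {z : ℂ}
    {U' : Fin d → Matrix (Fin N ⊕ Fin K) (Fin N ⊕ Fin K) ℂ} (h : IsMapF F Δ U Q z U')
    (hr : ∀ i, ‖blockProj N K * U' i - U' i * blockProj N K‖ ≤ r) :
    IsLocalProjector r (blockProj N K) U' where
  isProj := blockProj_isStarProjection
  unitary i := by
    rw [h.eq_pvmSum]
    exact h.dilation.isPVM.pvmSum_mem_unitaryGroup fun a => norm_limitPhase h.norm_z _
  commute i j := by
    rw [h.eq_pvmSum, h.eq_pvmSum, ← h.dilation.isPVM.pvmSum_mul, ← h.dilation.isPVM.pvmSum_mul,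
      mul_comm]
  norm_comm_le := hr

theorem IsSoftTorus.mono {ι : Type*} [Fintype ι] [DecidableEq ι] {d : ℕ} {ε ε' : ℝ}
    {U : Fin d → Matrix ι ι ℂ} (h : IsSoftTorus ε U) (hε : ε ≤ ε') : IsSoftTorus ε' U :=
  ⟨h.1, fun i j => (h.2 i j).trans hε⟩

theorem IsWindow.exists_isMapF_estimates {F : ℝ → ℝ} (hF : IsWindow F) :
    ∃ C : ℝ, 1 ≤ C ∧ ∀ (d N : ℕ) (ε : ℝ) (U : Fin d → Matrix (Fin N) (Fin N) ℂ),
      IsSoftTorus ε U → ∀ Δ : ℝ, 0 < Δ →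
        ∀ (K : ℕ) (Q : Outcome d Δ → Matrix (Fin N ⊕ Fin K) (Fin N ⊕ Fin K) ℂ) (z : ℂ)
          (U' : Fin d → Matrix (Fin N ⊕ Fin K) (Fin N ⊕ Fin K) ℂ), IsMapF F Δ U Q z U' → ∀ i,
            ‖(dilX Q i).toBlocks₁₁ - rePart (U i)‖ ≤ C * (Δ + d * ε / Δ) ∧
            ‖(dilY Q i).toBlocks₁₁ - imPart (U i)‖ ≤ C * (Δ + d * ε / Δ) ∧
            ‖(U' i - dilV Q i) * blockIncl N K‖ ≤ 6 * √(3 * (C * (Δ + d * ε / Δ))) ∧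
            ‖U' i * blockIncl N K - blockIncl N K * U i‖ ≤ 8 * √(3 * (C * (Δ + d * ε / Δ))) ∧
            ‖(U' i)ᴴ * blockIncl N K - blockIncl N K * (U i)ᴴ‖
              ≤ 8 * √(3 * (C * (Δ + d * ε / Δ))) := by
  obtain ⟨C, hC1, hC⟩ := hF.exists_softPOVM_moments_le
  refine ⟨C, hC1, fun d N ε U hU Δ hΔ K Q z U' h i => ?_⟩
  have hε : 0 ≤ ε := (norm_nonneg _).trans (hU.2 i i)
  obtain ⟨m1, m2, m3, m4⟩ := hC d N ε U hU Δ hΔ i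
  have hQ := h.dilation.isPVM
  rw [← pvmSum_toBlocks₁₁ h.dilation] at m1 m2 m3 m4
  rw [← hQ.pvmSum_real_mul_self] at m3 m4
  have hb : Δ ≤ C * (Δ + d * ε / Δ) := by
    have : 0 ≤ d * ε / Δ := by positivity
    nlinarith
  exact ⟨m1, m2, h.norm_intertwine_le hΔ hU.1 hb m1 m2 m3 m4⟩

end

theorem mainTheorem4 :
    (∃ F : ℝ → ℝ, IsWindow F) ∧
    ∀ F : ℝ → ℝ, IsWindow F → ∃ C : ℝ, 0 < C ∧
      ∀ (d N : ℕ) (ε : ℝ) (U : Fin d → Matrix (Fin N) (Fin N) ℂ),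
        1 ≤ d → 0 < ε → IsSoftTorus ε U →
        -- the construction can be carried out, for every width
        (∀ Δ : ℝ, 0 < Δ →
          IsPOVM (softPOVM F Δ U) ∧
          ∃ (K : ℕ) (Q : Outcome d Δ → Matrix (Fin N ⊕ Fin K) (Fin N ⊕ Fin K) ℂ) (z : ℂ)
            (U' : Fin d → Matrix (Fin N ⊕ Fin K) (Fin N ⊕ Fin K) ℂ),
            IsMapF F Δ U Q z U') ∧
        -- estimates for every width and every choice of the dilation and of `z`
        (∀ Δ : ℝ, 0 < Δ →
          ∀ (K : ℕ) (Q : Outcome d Δ → Matrix (Fin N ⊕ Fin K) (Fin N ⊕ Fin K) ℂ) (z : ℂ)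
            (U' : Fin d → Matrix (Fin N ⊕ Fin K) (Fin N ⊕ Fin K) ℂ),
            IsMapF F Δ U Q z U' → ∀ i,
              ‖(dilX Q i).toBlocks₁₁ - rePart (U i)‖ ≤ C * (Δ + d * ε / Δ) ∧
              ‖(dilY Q i).toBlocks₁₁ - imPart (U i)‖ ≤ C * (Δ + d * ε / Δ) ∧
              ‖blockProj N K * (U' i - dilV Q i) * blockProj N K‖
                ≤ C * (Δ + d * ε / Δ) ^ (1 / 2 : ℝ)) ∧
        -- the width `Δ = √(d ε)`: the map `ℱ` and the composition `𝒢 ∘ ℱ`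
        (∀ Δ : ℝ, Δ = √(d * ε) →
          ∀ (K : ℕ) (Q : Outcome d Δ → Matrix (Fin N ⊕ Fin K) (Fin N ⊕ Fin K) ℂ) (z : ℂ)
            (U' : Fin d → Matrix (Fin N ⊕ Fin K) (Fin N ⊕ Fin K) ℂ),
            IsMapF F Δ U Q z U' →
              (∀ i,
                ‖(dilX Q i).toBlocks₁₁ - rePart (U i)‖ ≤ C * √(d * ε) ∧
                ‖(dilY Q i).toBlocks₁₁ - imPart (U i)‖ ≤ C * √(d * ε) ∧
                ‖blockProj N K * (U' i - dilV Q i) * blockProj N K‖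
                  ≤ C * (d * ε) ^ (1 / 4 : ℝ)) ∧
              IsLocalProjector (C * (d * ε) ^ (1 / 4 : ℝ)) (blockProj N K) U' ∧
              ∀ δ : ℝ, δ < 0.6 → IsLocalProjector δ (blockProj N K) U' →
                (∀ i, IsUnit (U' i).toBlocks₁₁) ∧
                (∀ i, ‖mapG U' i - U i‖ ≤ C * (d * ε) ^ (1 / 4 : ℝ)) ∧
                IsSoftTorus (C * (d * ε) ^ (1 / 2 : ℝ)) (mapG U')) := by
  refine ⟨exists_isWindow, fun F hF => ?_⟩
  obtain ⟨C, hC1, hC⟩ := hF.exists_isMapF_estimates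
  -- √(3C) ≤ 3C because C ≥ 1.
  have hsqrt : ∀ b : ℝ, √(3 * (C * b)) ≤ 3 * C * √b := by
    intro b
    rw [← mul_assoc, Real.sqrt_mul (by linarith)]
    refine mul_le_mul_of_nonneg_right (Real.sqrt_le_iff.2 ⟨by linarith, by nlinarith⟩)
      (Real.sqrt_nonneg _)
  have hbound : ∀ {x y c : ℝ}, 0 ≤ y → c ≤ 10000 → x ≤ c * (C * y) → x ≤ 10000 * C * y := by
    intro x y c hy hc hx
    have : 0 ≤ C * y := by positivity
    nlinarith
  -- The largest factor required is 9216 = 6 · 16² · 6, from the soft torus bound 6(16r)² with r² =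
  -- 6CΔ.
  refine ⟨10000 * C, by linarith, fun d N ε U hd hε hU => ⟨fun Δ hΔ =>
    ⟨hF.softPOVM_isPOVM hΔ hU.1, hF.exists_isMapF hΔ hU.1⟩, fun Δ hΔ K Q z U' h i => ?_,
    fun Δ hΔe K Q z U' h => ?_⟩⟩
  · obtain ⟨h1, h2, h3, -, -⟩ := hC d N ε U hU Δ hΔ K Q z U' h i
    have hb : 0 ≤ Δ + d * ε / Δ := by positivity
    refine ⟨hbound hb (c := 1) (by norm_num) (by linarith),
      hbound hb (c := 1) (by norm_num) (by linarith), ?_⟩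
    rw [← Real.sqrt_eq_rpow]
    refine hbound (Real.sqrt_nonneg _) (c := 18) (by norm_num)
      ((norm_blockProj_mul_mul_le _).trans (h3.trans ?_))
    linarith [hsqrt (Δ + d * ε / Δ)]
  · have hdε : 0 < d * ε := by positivity
    have hΔ : 0 < Δ := by rw [hΔe]; exact Real.sqrt_pos.2 hdε
    have hΔ2 : Δ * Δ = d * ε := by rw [hΔe]; exact Real.mul_self_sqrt hdε.le
    -- At this width the two error terms coincide, and (dε)^(1/4) is √Δ.
    have hb : Δ + d * ε / Δ = 2 * Δ := by rw [← hΔ2]; field_simp; ring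
    have hq : (d * ε) ^ (1 / 4 : ℝ) = √Δ := by
      rw [hΔe, Real.sqrt_eq_rpow, Real.sqrt_eq_rpow, ← Real.rpow_mul hdε.le]
      norm_num
    have hr : √(3 * (C * (Δ + d * ε / Δ))) ≤ 6 * C * √Δ := by
      rw [hb]
      have e2 : √(2 * Δ) ≤ 2 * √Δ := by
        rw [Real.sqrt_mul zero_le_two]
        refine mul_le_mul_of_nonneg_right ?_ (Real.sqrt_nonneg _)
        exact Real.sqrt_le_iff.2 ⟨by norm_num, by norm_num⟩
      calc _ ≤ 3 * C * √(2 * Δ) := hsqrt _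
        _ ≤ 3 * C * (2 * √Δ) := by gcongr
        _ = _ := by ring
    have hr2 : √(3 * (C * (Δ + d * ε / Δ))) ^ 2 = 6 * C * Δ := by
      rw [Real.sq_sqrt (by positivity), hb]; ring
    have hest := hC d N ε U hU Δ hΔ K Q z U' h
    set r := √(3 * (C * (Δ + d * ε / Δ))) with hrdef
    have hs0 : 0 ≤ √Δ := Real.sqrt_nonneg _
    have hcomm : ∀ i, ‖blockProj N K * U' i - U' i * blockProj N K‖ ≤ 16 * r := fun i => by
      obtain ⟨-, -, -, h4, h5⟩ := hest i
      linarith [norm_commutator_blockProj_le h4 h5]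
    rw [hq, ← Real.sqrt_eq_rpow, ← hΔe]
    refine ⟨fun i => ?_, h.isLocalProjector fun i => (hcomm i).trans
      (hbound hs0 (c := 96) (by norm_num) (by linarith)), fun δ hδ hloc => ?_⟩
    · obtain ⟨h1, h2, h3, -, -⟩ := hest i
      rw [hb] at h1 h2
      refine ⟨hbound hΔ.le (c := 2) (by norm_num) (by linarith),
        hbound hΔ.le (c := 2) (by norm_num) (by linarith),
        hbound hs0 (c := 36) (by norm_num) ((norm_blockProj_mul_mul_le _).trans (h3.trans ?_))⟩
      linarith
    · obtain ⟨g1, g2, g3⟩ := mapG_estimates (by norm_num at hδ; linarith) hloc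
        (fun i => (hest i).2.2.2.1) hcomm
      refine ⟨g1, fun i => (g2 i).trans (hbound hs0 (c := 144) (by norm_num) (by linarith)),
        g3.mono (hbound hΔ.le (c := 9216) (by norm_num) ?_)⟩
      rw [mul_pow, hr2]
      linarith
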